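/- **Theorem (minimax lower bound for banded covariance operators).** Let $d\ge 1$, $D=[0,1]^d$ with Lebesgue measure and the Euclidean distance. For a nonzero trace-class covariance operator $\mathcal C$ on $L^2(D)$, write $\|\mathcal C\|$ for its operator norm, $\mathrm{Tr}(\mathcal C)$ for its trace and $r(\mathcal C)=\mathrm{Tr}(\mathcal C)/\|\mathcal C\|$ for its effective dimension. Given $r>1$, a positive decreasing sequence $\{\nu_m\}_{m\ge 1}$ with $\nu_1=1$, and constants $c_1,c_2>0$, let $\mathcal F(r,\{\nu_m\})$ be the class of all nonzero trace-class operators $\mathcal C$ on $L^2(D)$ of the form $(\mathcal C\psi)(x)=\int_D k(x,y)\psi(y)\,dy$, where $k$ is a measurable covariance function (symmetric and positive semi-definite), such that $$\sup_{x\in D}k(x,x)\le c_1\mathrm{Tr}(\mathcal C),\qquad r(\mathcal C)\le r,\qquad \sup_{x\in D}\int_{\{y:\|x-y\|>m\,r(\mathcal C)^{-1/d}\}}|k(x,y)|\,dy\le c_2\|\mathcal C\|\,\nu_m\quad\text{for all integers } m\ge 1 .$$ For a positive integer $N$ put $$\varepsilon_*=\max_{m\ge 1}\ \min\Big\{\nu_m,\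 \sqrt{m^d/N}\Big\}.$$ There is a constant $C_0>0$ depending only on $d$ such that for all $c_1\ge C_0$ and $c_2>0$ there is a constant $c>0$, depending only on $d,c_1,c_2$, such that for every such sequence $\{\nu_m\}$, every $N$ and every real $r$ with $N>\log r>0$, $$\inf_{\hat{\mathcal C}}\ \sup_{\mathcal C\in\mathcal F(r,\{\nu_m\})}\frac{\mathbb E\|\hat{\mathcal C}-\mathcal C\|}{\|\mathcal C\|}\ \ge\ c\,\min\left\{\varepsilon_*+\sqrt{\frac{\log r}{N}},\ \sqrt{\frac rN}\right\}.$$ Here the expectation is over $N$ independent copies $u_1,\dots,u_N$ of a centered Gaussian random element of $L^2(D)$ with covariance operator $\mathcal C$, and the infimum is over all estimators $\hat{\mathcal C}$, that is, all (weakly) measurable maps from the data $(u_1,\dots,u_N)\in L^2(D)^N$ to the bounded linear operators on $L^2(D)$; these include all bounded integral operators whose kernel is a measurable function of the data. -/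

import Mathlib

open MeasureTheory ProbabilityTheory
open scoped ENNReal RealInnerProductSpace

noncomputable section

namespace BandedCovariance

/-- The physical domain `D = [0,1]^d`, with Lebesgue (product) measure as its `volume`. -/
abbrev Cube (d : ℕ) : Type := Fin d → unitInterval

/-- The Euclidean distance on `[0,1]^d` (the `dist` of the product type is the sup distance). -/
def euclDist {d : ℕ} (x y : Cube d) : ℝ := √(∑ i, ((x i : ℝ) - (y i : ℝ)) ^ 2)

/-- The real Hilbert space `L²(D)`. -/
abbrev L2 (d : ℕ) : Type := Lp ℝ 2 (volume : Measure (Cube d))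

instance instMeasurableSpaceL2 (d : ℕ) : MeasurableSpace (L2 d) := borel (L2 d)

instance instBorelSpaceL2 (d : ℕ) : BorelSpace (L2 d) := ⟨rfl⟩

/-- A measurable covariance function on `D`: a jointly measurable, symmetric, positive
semi-definite kernel. -/
structure IsCovarianceFunction {d : ℕ} (k : Cube d → Cube d → ℝ) : Prop where
  measurable : Measurable (Function.uncurry k)
  posSemidef : ∀ (n : ℕ) (x : Fin n → Cube d),
    (Matrix.of fun i j => k (x i) (x j)).PosSemidef

/-- `C` is the integral operator `(C ψ)(x) = ∫ k(x, y) ψ(y) dy` on `L²(D)`. -/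
def IsIntegralOperator {d : ℕ} (C : L2 d →L[ℝ] L2 d) (k : Cube d → Cube d → ℝ) : Prop :=
  ∀ ψ : L2 d, ∀ᵐ x, C ψ x = ∫ y, k x y * ψ y

/-- The trace of a positive operator, with values in `[0, ∞]`: the supremum of `∑ ⟪C eᵢ, eᵢ⟫` over
all finite orthonormal systems. It equals `∑ ⟪C eᵢ, eᵢ⟫` for every orthonormal basis, and a
positive operator is trace class iff it is finite. -/
def opTrace {d : ℕ} (C : L2 d →L[ℝ] L2 d) : ℝ≥0∞ :=
  ⨆ (n : ℕ) (e : Fin n → L2 d) (_ : Orthonormal ℝ e), ∑ i, ENNReal.ofReal ⟪C (e i), e i⟫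

/-- The effective dimension `r(C) = Tr(C) / ‖C‖`. -/
def effDim {d : ℕ} (C : L2 d →L[ℝ] L2 d) : ℝ := (opTrace C).toReal / ‖C‖

/-- The banded class `𝓕(r, {ν_m})` with implicit constants `c₁` (size of the diagonal) and `c₂`
(off-diagonal decay): the nonzero trace-class covariance operators `C` with a covariance function
`k` such that `sup_x k(x,x) ≤ c₁ Tr(C)`, `r(C) ≤ r`, and, for all `m ≥ 1`,
`sup_x ∫_{‖x - y‖ > m r(C)^{-1/d}} |k(x,y)| dy ≤ c₂ ‖C‖ ν_m`. -/
def bandedClass (d : ℕ) (c₁ c₂ r : ℝ) (ν : ℕ+ → ℝ) : Set (L2 d →L[ℝ] L2 d) :=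
  {C | C ≠ 0 ∧ opTrace C ≠ ∞ ∧ effDim C ≤ r ∧
    ∃ k : Cube d → Cube d → ℝ, IsCovarianceFunction k ∧ IsIntegralOperator C k ∧
      (∀ x, k x x ≤ c₁ * (opTrace C).toReal) ∧
      ∀ (m : ℕ+) (x : Cube d),
        ∫ y in {y | (m : ℝ) * effDim C ^ (-(1 / d : ℝ)) < euclDist x y}, |k x y| ≤ c₂ * ‖C‖ * ν m}

/-- `μ` is the law `GP(0, C)` on `L²(D)`: Gaussian and centered with covariance operator `C`. -/
structure IsGP {d : ℕ} (μ : Measure (L2 d)) (C : L2 d →L[ℝ] L2 d) : Prop where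
  isGaussian : IsGaussian μ
  mean_eq_zero : ∫ u, u ∂μ = 0
  covariance_eq : covarianceOperator μ = C

/-- An estimator of the covariance operator from `N` sample paths: a (weakly) measurable map from
the data to the bounded operators on `L²(D)`. -/
def IsEstimator {d N : ℕ} (T : (Fin N → L2 d) → (L2 d →L[ℝ] L2 d)) : Prop :=
  ∀ ψ φ : L2 d, Measurable fun U => ⟪T U ψ, φ⟫

/-- The relative operator-norm risk `𝔼 ‖Ĉ - C‖ / ‖C‖` of the estimator `T` when the data are `N`
independent copies of `u ∼ μ`. -/
def relRisk {d N : ℕ} (T : (Fin N → L2 d) → (L2 d →L[ℝ] L2 d)) (C : L2 d →L[ℝ] L2 d)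
    (μ : Measure (L2 d)) : ℝ≥0∞ :=
  (∫⁻ U, ‖T U - C‖ₑ ∂(Measure.pi fun _ : Fin N => μ)) / ‖C‖ₑ

/-- The minimax relative risk over a class `F` of covariance operators. (The law `μ = GP(0, C)` is
determined by `C`, so that the inner supremum is over `C ∈ F` only.) -/
def minimaxRisk (d N : ℕ) (F : Set (L2 d →L[ℝ] L2 d)) : ℝ≥0∞ :=
  ⨅ (T : (Fin N → L2 d) → (L2 d →L[ℝ] L2 d)) (_ : IsEstimator T),
    ⨆ (C ∈ F) (μ : Measure (L2 d)) (_ : IsGP μ C), relRisk T C μ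

/-- `ε_* = max_m min {ν_m, √(m^d / N)}`. -/
def epsStar (ν : ℕ+ → ℝ) (N d : ℕ) : ℝ := ⨆ m : ℕ+, min (ν m) √((m : ℝ) ^ d / N)

/-- The supremum in `epsStar` is attained. -/
theorem isGreatest_epsStar {ν : ℕ+ → ℝ} (hanti : Antitone ν) {N d : ℕ}
    (hN : 1 ≤ N) (hd : 1 ≤ d) :
    IsGreatest (Set.range fun m : ℕ+ => min (ν m) √((m : ℝ) ^ d / N)) (epsStar ν N d) := by
  set f : ℕ+ → ℝ := fun m => min (ν m) √((m : ℝ) ^ d / N) with hf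
  have hbdd : BddAbove (Set.range f) :=
    ⟨ν 1, by rintro _ ⟨m, rfl⟩; exact (min_le_left _ _).trans (hanti one_le)⟩
  have hN0 : (0 : ℝ) < N := by exact_mod_cast hN
  -- beyond some index the first term is the smaller one
  obtain ⟨M, hM⟩ : ∃ M : ℕ+, ν M ≤ √((M : ℝ) ^ d / N) := by
    obtain ⟨n, hn⟩ := exists_nat_gt ((N : ℝ) * (1 + ν 1 ^ 2))
    have hn0 : 0 < n := by
      have : (0 : ℝ) < n := lt_of_le_of_lt (by positivity) hn
      exact_mod_cast this
    obtain ⟨p, rfl⟩ : ∃ p : ℕ+, (p : ℕ) = n := ⟨⟨n, hn0⟩, rfl⟩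
    refine ⟨p, (hanti one_le).trans (Real.le_sqrt_of_sq_le ?_)⟩
    rw [le_div_iff₀ hN0]
    have h1 : (1 : ℝ) ≤ (p : ℕ) := by exact_mod_cast hn0
    have h2 : ((p : ℕ) : ℝ) ≤ ((p : ℕ) : ℝ) ^ d := le_self_pow₀ h1 (by omega)
    nlinarith
  obtain ⟨m₀, -, hm₀⟩ := Finset.exists_max_image (Finset.Icc 1 M) f
    ⟨1, Finset.mem_Icc.2 ⟨le_rfl, one_le⟩⟩
  have hmax : ∀ m, f m ≤ f m₀ := by
    intro m
    rcases le_total m M with h | h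
    · exact hm₀ m (Finset.mem_Icc.2 ⟨one_le, h⟩)
    · refine le_trans ?_ (hm₀ M (Finset.mem_Icc.2 ⟨one_le, le_rfl⟩))
      exact (min_le_left _ _).trans ((hanti h).trans (le_min le_rfl hM))
  have heq : epsStar ν N d = f m₀ := le_antisymm (ciSup_le hmax) (le_ciSup hbdd m₀)
  refine ⟨⟨m₀, heq.symm⟩, ?_⟩
  rintro _ ⟨m, rfl⟩
  exact le_ciSup hbdd m

end BandedCovariance

end

/-!
The lower bound is the sum of two testing bounds, both for Gaussian vectors of the form
`u = ∑ₖ zₖ fₖ` with independent standard Gaussian `zₖ`, whose covariance operator is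
`∑ₖ fₖ ⊗ fₖ`. The `fₖ` are combinations `∑ᵢ β k i • eᵢ` of the normalised indicators `eᵢ` of about
`r` cells of a grid of mesh of order `r ^ (-1/d)`. In these coordinates the operator is the matrix
`βᵀ β`, and belonging to the banded class means that the off-diagonal entries of `βᵀ β` have row
sums at most `c₂ ν_m` and live on a block of side `m` cells
(`CellFamily.covOp_mem_bandedClass`). The cells are small enough for the diagonal entries never to
contribute to the tails, and they fill a fixed fraction of the cube, which is what the lower bound
on `c₁` is for.

*The term `√(log r / N)`* (`minimaxRisk_ge_log`). The identity is tested against the uniform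
mixture, over the `R = ⌊r⌋` coordinates, of the alternatives in which one coordinate has variance
`1 + δ`. The likelihood ratios of different coordinates are independent, so the mixture has second
moment at most `1 + exp (N δ²) / R` under white noise; this stays bounded for
`δ² ≍ (1 + log R) / N`.
The error of an estimator at the null hypothesis and its error at the alternatives add up to at
least `δ`, so that one of them is of order `δ`. Since `R = 1` is allowed, this also gives the
parametric rate `1 / √N`.

*The term `ε_*`* (`minimaxRisk_ge_band`). Inside a block of `m ^ d ≤ r` cells, two disjoint sets `A`
and `B` of `p ≍ m ^ d` cells are chosen. The coordinates in `B` are independent noise plus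
`t θᵢ ∑_{k ∈ A} zₖ`, where `θ` is an unknown sign vector. The off-diagonal row sums and the size of
the perturbation in operator norm are both of order `ε = t p`. Changing one sign shears white noise
along a single coordinate, so that the likelihood ratios are explicit
(`two_point_shear`), and the two hypotheses cannot be told apart as long as `N t² p ≤ 1/2`, that is,
`ε² ≲ m ^ d / N`. The value of `Ĉ - C` at the normalised sum of the `eₖ` over `A` has
`p` coordinates in `B`, each of which is wrong by about `ε / √p` on average over the signs; by
Bessel's inequality the operator norm is at least of order `ε` (`CellFamily.le_risk_of_spike`).
This is Assouad's lemma, carried out directly on linear functionals of the estimator.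

Finally, a bandwidth `m` with `m ^ d > r` can be replaced by `⌊r ^ (1/d)⌋` at the price of the term
`√(r / N)` (`exists_bandwidth`), and blocks of fewer than four cells are covered by the parametric
rate.
-/

namespace BandedCovariance

/-! ### Products of densities -/

theorem lintegral_pi_prod {ι : Type*} [Fintype ι] {X : ι → Type*} [∀ i, MeasurableSpace (X i)]
    (μ : ∀ i, Measure (X i)) [∀ i, IsProbabilityMeasure (μ i)] (f : ∀ i, X i → ℝ≥0∞)
    (hf : ∀ i, Measurable (f i)) :
    ∫⁻ x, ∏ i, f i (x i) ∂Measure.pi μ = ∏ i, ∫⁻ x, f i x ∂μ i := by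
  have hind : iIndepFun (fun i (x : ∀ i, X i) => f i (x i)) (Measure.pi μ) :=
    iIndepFun_pi fun i => (hf i).aemeasurable
  rw [lintegral_prod_eq_prod_lintegral_of_indepFun Finset.univ _ hind
    fun i => (hf i).comp (measurable_pi_apply i)]
  refine Finset.prod_congr rfl fun i _ => ?_
  exact (measurePreserving_eval μ i).lintegral_comp (hf i)

theorem pi_withDensity {ι : Type*} [Fintype ι] {X : ι → Type*} [∀ i, MeasurableSpace (X i)]
    (μ : ∀ i, Measure (X i)) [∀ i, IsProbabilityMeasure (μ i)] (f : ∀ i, X i → ℝ≥0∞)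
    (hf : ∀ i, Measurable (f i)) [∀ i, SigmaFinite ((μ i).withDensity (f i))] :
    Measure.pi (fun i => (μ i).withDensity (f i)) =
      (Measure.pi μ).withDensity fun x => ∏ i, f i (x i) := by
  refine Measure.pi_eq fun s hs => ?_
  rw [withDensity_apply _ (MeasurableSet.univ_pi hs),
    ← lintegral_indicator (MeasurableSet.univ_pi hs)]
  have h : (Set.univ.pi s).indicator (fun x => ∏ i, f i (x i)) =
      fun x => ∏ i, (s i).indicator (f i) (x i) := by
    ext x
    by_cases hx : x ∈ Set.univ.pi s
    · rw [Set.indicator_of_mem hx]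
      exact Finset.prod_congr rfl fun i _ => (Set.indicator_of_mem (hx i trivial) _).symm
    · rw [Set.indicator_of_notMem hx]
      obtain ⟨i, hi⟩ : ∃ i, x i ∉ s i := by simpa [Set.mem_pi] using hx
      exact (Finset.prod_eq_zero (Finset.mem_univ i) (Set.indicator_of_notMem hi _)).symm
  rw [h, lintegral_pi_prod μ _ fun i => (hf i).indicator (hs i)]
  refine Finset.prod_congr rfl fun i _ => ?_
  rw [lintegral_indicator (hs i), withDensity_apply _ (hs i)]

/-! ### White noise and changes of measure -/

/-- White noise indexed by `ι`: the law of independent standard Gaussian coordinates. -/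
noncomputable def whiteNoise (ι : Type*) [Fintype ι] : Measure (ι → ℝ) :=
  Measure.pi fun _ : ι => gaussianReal 0 1

instance (ι : Type*) [Fintype ι] : IsProbabilityMeasure (whiteNoise ι) := by
  unfold whiteNoise; infer_instance

/-- The law of `N` independent copies of white noise. -/
noncomputable def noiseSample (N : ℕ) (ι : Type*) [Fintype ι] : Measure (Fin N → ι → ℝ) :=
  Measure.pi fun _ : Fin N => whiteNoise ι

instance (N : ℕ) (ι : Type*) [Fintype ι] : IsProbabilityMeasure (noiseSample N ι) := by
  unfold noiseSample; infer_instance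

/-- By Fubini, a map of white noise that changes only the coordinate `i` has the density `L` as soon
as it does so when the other coordinates are frozen. -/
theorem whiteNoise_map_update {ι : Type*} [Fintype ι] [DecidableEq ι] (i : ι)
    (g : (ι → ℝ) → ℝ) (hg : Measurable g) (L : (ι → ℝ) → ℝ≥0∞) (hL : Measurable L)
    (h : ∀ (x : ι → ℝ) (F : ℝ → ℝ≥0∞), Measurable F →
      ∫⁻ y, F (g (Function.update x i y)) ∂gaussianReal 0 1 =
        ∫⁻ y, F y * L (Function.update x i y) ∂gaussianReal 0 1) :
    (whiteNoise ι).map (fun x => Function.update x i (g x)) = (whiteNoise ι).withDensity L := by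
  have hS : Measurable fun x : ι → ℝ => Function.update x i (g x) := by
    rw [measurable_pi_iff]
    intro j
    by_cases hj : j = i
    · subst hj; simpa using hg
    · simpa [Function.update_of_ne hj] using measurable_pi_apply j
  refine Measure.ext_of_lintegral _ fun F hF => ?_
  rw [lintegral_map hF hS, lintegral_withDensity_eq_lintegral_mul _ hL hF]
  refine lintegral_eq_of_lmarginal_eq {i} (hF.comp hS) (hL.mul hF) ?_
  ext x
  simp only [lmarginal_singleton]
  have := h x (fun y => F (Function.update x i y)) (hF.comp (measurable_update x))
  simp only [Function.update_idem, Pi.mul_apply] at this ⊢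
  rw [this]
  simp only [mul_comm]

theorem lintegral_noiseSample_map {N : ℕ} {ι : Type*} [Fintype ι] (S : (ι → ℝ) → ι → ℝ)
    (hS : Measurable S) (L : (ι → ℝ) → ℝ≥0∞) (hL : Measurable L)
    (h : (whiteNoise ι).map S = (whiteNoise ι).withDensity L)
    (G : (Fin N → ι → ℝ) → ℝ≥0∞) (hG : Measurable G) :
    ∫⁻ z, G (fun n => S (z n)) ∂noiseSample N ι =
      ∫⁻ z, G z * ∏ n, L (z n) ∂noiseSample N ι := by
  have hp : IsProbabilityMeasure ((whiteNoise ι).map S) :=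
    Measure.isProbabilityMeasure_map hS.aemeasurable
  have hp' : IsProbabilityMeasure ((whiteNoise ι).withDensity L) := h ▸ hp
  have hmap : (noiseSample N ι).map (fun z n => S (z n)) =
      (noiseSample N ι).withDensity fun z => ∏ n, L (z n) := by
    unfold noiseSample
    rw [Measure.pi_map_pi fun _ => hS.aemeasurable, h]
    exact pi_withDensity (fun _ => whiteNoise ι) (fun _ => L) fun _ => hL
  have hS' : Measurable fun (z : Fin N → ι → ℝ) n => S (z n) := by fun_prop
  rw [← lintegral_map hG hS', hmap, lintegral_withDensity_eq_lintegral_mul _ (by fun_prop) hG]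
  simp [mul_comm]

theorem gaussian_shift (c : ℝ) (F : ℝ → ℝ≥0∞) (hF : Measurable F) :
    ∫⁻ y, F (y + c) ∂gaussianReal 0 1 =
      ∫⁻ y, F y * ENNReal.ofReal (Real.exp (c * y - c ^ 2 / 2)) ∂gaussianReal 0 1 := by
  rw [← lintegral_map (f := F) (g := fun y => y + c) hF (by fun_prop), gaussianReal_map_add_const,
    gaussianReal_of_var_ne_zero _ one_ne_zero, gaussianReal_of_var_ne_zero _ one_ne_zero,
    lintegral_withDensity_eq_lintegral_mul _ (measurable_gaussianPDF _ _) hF,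
    lintegral_withDensity_eq_lintegral_mul _ (measurable_gaussianPDF _ _) (by fun_prop)]
  refine lintegral_congr fun y => ?_
  simp only [Pi.mul_apply, gaussianPDF]
  rw [mul_left_comm, mul_comm, ← ENNReal.ofReal_mul (gaussianPDFReal_nonneg _ _ _)]
  congr 2
  simp only [gaussianPDFReal, NNReal.coe_one]
  rw [mul_assoc _ (Real.exp _), ← Real.exp_add]
  congr 2
  ring

theorem whiteNoise_map_shear {ι : Type*} [Fintype ι] [DecidableEq ι] (i : ι)
    (s : (ι → ℝ) → ℝ) (hs : Measurable s) (hsi : ∀ x y, s (Function.update x i y) = s x) :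
    (whiteNoise ι).map (fun x => Function.update x i (x i + s x)) =
      (whiteNoise ι).withDensity
        fun x => ENNReal.ofReal (Real.exp (s x * x i - s x ^ 2 / 2)) := by
  refine whiteNoise_map_update i _ (by fun_prop) _ (by fun_prop) fun x F hF => ?_
  simp only [Function.update_self, hsi]
  exact gaussian_shift (s x) F hF

/-- The density of `gaussianReal 0 v` with respect to `gaussianReal 0 1`. -/
noncomputable def scaleDensity (v y : ℝ) : ℝ≥0∞ :=
  ENNReal.ofReal ((√v)⁻¹ * Real.exp (y ^ 2 / 2 * (1 - v⁻¹)))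

@[fun_prop]
theorem measurable_scaleDensity (v : ℝ) : Measurable (scaleDensity v) := by
  unfold scaleDensity; fun_prop

theorem gaussian_scale {v : ℝ} (hv : 0 < v) (F : ℝ → ℝ≥0∞) (hF : Measurable F) :
    ∫⁻ y, F (√v * y) ∂gaussianReal 0 1 = ∫⁻ y, F y * scaleDensity v y ∂gaussianReal 0 1 := by
  have hw : NNReal.mk (√v ^ 2) (sq_nonneg _) * 1 ≠ 0 := by
    rw [mul_one, ne_eq, ← NNReal.coe_eq_zero, NNReal.coe_mk, Real.sq_sqrt hv.le]; exact hv.ne'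
  rw [← lintegral_map (f := F) (g := fun y => √v * y) hF (by fun_prop),
    gaussianReal_map_const_mul, gaussianReal_of_var_ne_zero _ hw,
    gaussianReal_of_var_ne_zero _ one_ne_zero,
    lintegral_withDensity_eq_lintegral_mul _ (measurable_gaussianPDF _ _) hF,
    lintegral_withDensity_eq_lintegral_mul _ (measurable_gaussianPDF _ _) (by fun_prop)]
  refine lintegral_congr fun y => ?_
  simp only [Pi.mul_apply, gaussianPDF, scaleDensity]
  rw [mul_left_comm, mul_comm, ← ENNReal.ofReal_mul (gaussianPDFReal_nonneg _ _ _)]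
  congr 2
  simp only [gaussianPDFReal, NNReal.coe_one, NNReal.coe_mk, Real.sq_sqrt hv.le,
    mul_one, mul_zero, sub_zero]
  rw [Real.sqrt_mul (by positivity : (0 : ℝ) ≤ 2 * Real.pi), mul_inv, mul_mul_mul_comm,
    ← Real.exp_add]
  congr 2
  field_simp
  ring

theorem whiteNoise_map_scale {ι : Type*} [Fintype ι] [DecidableEq ι] (i : ι) {v : ℝ}
    (hv : 0 < v) :
    (whiteNoise ι).map (fun x => Function.update x i (√v * x i)) =
      (whiteNoise ι).withDensity fun x => scaleDensity v (x i) := by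
  refine whiteNoise_map_update i _ (by fun_prop) _ (by fun_prop) fun x F hF => ?_
  simp only [Function.update_self]
  exact gaussian_scale hv F hF

theorem lintegral_scaleDensity {v : ℝ} (hv : 0 < v) :
    ∫⁻ y, scaleDensity v y ∂gaussianReal 0 1 = 1 := by
  simpa using (gaussian_scale hv (fun _ => 1) measurable_const).symm

/-- The second moment of the density equals `(1 - δ²)^{-1/2}`. -/
theorem lintegral_scaleDensity_sq {δ : ℝ} (h0 : 0 ≤ δ) (h1 : δ ^ 2 ≤ 1 / 2) :
    ∫⁻ y, scaleDensity (1 + δ) y * scaleDensity (1 + δ) y ∂gaussianReal 0 1 ≤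
      ENNReal.ofReal (Real.exp (δ ^ 2)) := by
  have hδ : δ < 1 := by nlinarith
  have hv : 0 < 1 + δ := by linarith
  have hv' : 0 < 1 - δ := by linarith
  -- the squared density times the standard Gaussian density is a multiple of the density of
  -- variance `w`
  set w : NNReal := NNReal.mk ((1 + δ) / (1 - δ)) (by positivity) with hw
  have hw0 : w ≠ 0 := by
    rw [ne_eq, ← NNReal.coe_eq_zero, hw, NNReal.coe_mk]; positivity
  rw [gaussianReal_of_var_ne_zero _ one_ne_zero,
    lintegral_withDensity_eq_lintegral_mul _ (measurable_gaussianPDF _ _) (by fun_prop)]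
  have key : ∀ y, gaussianPDF 0 1 y * (scaleDensity (1 + δ) y * scaleDensity (1 + δ) y) =
      ENNReal.ofReal ((1 + δ)⁻¹ * √((1 + δ) / (1 - δ))) * gaussianPDF 0 w y := by
    intro y
    simp only [gaussianPDF, scaleDensity]
    rw [← ENNReal.ofReal_mul (by positivity), ← ENNReal.ofReal_mul (gaussianPDFReal_nonneg _ _ _),
      ← ENNReal.ofReal_mul (by positivity)]
    congr 1
    simp only [gaussianPDFReal, NNReal.coe_one, hw, NNReal.coe_mk, mul_one, sub_zero]
    have e1 : (√(1 + δ))⁻¹ * Real.exp (y ^ 2 / 2 * (1 - (1 + δ)⁻¹)) *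
        ((√(1 + δ))⁻¹ * Real.exp (y ^ 2 / 2 * (1 - (1 + δ)⁻¹))) =
        (1 + δ)⁻¹ * Real.exp (y ^ 2 * (1 - (1 + δ)⁻¹)) := by
      rw [mul_mul_mul_comm, ← mul_inv, Real.mul_self_sqrt hv.le, ← Real.exp_add]
      congr 2; ring
    rw [e1, Real.sqrt_mul (by positivity : (0 : ℝ) ≤ 2 * Real.pi) ((1 + δ) / (1 - δ)), mul_inv]
    have hs : 0 < √((1 + δ) / (1 - δ)) := Real.sqrt_pos.2 (by positivity)
    rw [mul_mul_mul_comm, ← Real.exp_add]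
    have : -y ^ 2 / 2 + y ^ 2 * (1 - (1 + δ)⁻¹) = -y ^ 2 / (2 * ((1 + δ) / (1 - δ))) := by
      field_simp; ring
    rw [this]
    field_simp
  simp only [Pi.mul_apply, key]
  rw [lintegral_const_mul _ (measurable_gaussianPDF _ _), lintegral_gaussianPDF_eq_one _ hw0,
    mul_one]
  refine ENNReal.ofReal_le_ofReal ?_
  refine le_of_sq_le_sq ?_ (Real.exp_pos _).le
  rw [mul_pow, Real.sq_sqrt (by positivity), ← Real.exp_nat_mul]
  have h2 : 1 + 2 * δ ^ 2 ≤ Real.exp ((2 : ℕ) * δ ^ 2) := by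
    have := Real.add_one_le_exp ((2 : ℕ) * δ ^ 2); push_cast at this ⊢; linarith
  refine le_trans ?_ h2
  have : ((1 + δ)⁻¹) ^ 2 * ((1 + δ) / (1 - δ)) = 1 / (1 - δ ^ 2) := by
    have : (1 : ℝ) - δ ^ 2 ≠ 0 := by nlinarith
    field_simp; ring
  rw [this, div_le_iff₀ (by linarith)]
  nlinarith [sq_nonneg δ]

/-! ### Gaussian vectors with finitely many coordinates -/

theorem memLp_coord {ι : Type*} [Fintype ι] (i : ι) :
    MemLp (fun z : ι → ℝ => z i) 2 (whiteNoise ι) :=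
  (memLp_id_gaussianReal' 2 (by simp)).comp_measurePreserving
    (measurePreserving_eval (fun _ : ι => gaussianReal 0 1) i)

theorem integral_coord {ι : Type*} [Fintype ι] (i : ι) :
    ∫ z, z i ∂whiteNoise ι = 0 := by
  unfold whiteNoise
  rw [integral_comp_eval (X := fun _ => ℝ) (f := fun x : ℝ => x) (by fun_prop)]
  simp

theorem integral_coord_mul {ι : Type*} [Fintype ι] [DecidableEq ι] (i j : ι) :
    ∫ z, z i * z j ∂whiteNoise ι = if i = j then 1 else 0 := by
  split_ifs with h
  · subst h
    unfold whiteNoise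
    rw [integral_comp_eval (X := fun _ => ℝ) (f := fun x : ℝ => x * x) (by fun_prop)]
    have h1 := variance_eq_integral (X := fun x : ℝ => x) (μ := gaussianReal 0 1) (by fun_prop)
    simp only [variance_fun_id_gaussianReal, integral_id_gaussianReal, sub_zero,
      NNReal.coe_one] at h1
    rw [h1]
    exact integral_congr_ae (Filter.Eventually.of_forall fun x => (sq x).symm)
  · have hind : iIndepFun (fun i (x : ι → ℝ) => x i) (whiteNoise ι) :=
      iIndepFun_pi (X := fun _ x => x) fun i => aemeasurable_id
    rw [(hind.indepFun h).integral_fun_mul_eq_mul_integral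
        (measurable_pi_apply i).aestronglyMeasurable (measurable_pi_apply j).aestronglyMeasurable,
      integral_coord, zero_mul]

theorem integral_linear_mul_linear {ι : Type*} [Fintype ι] (α β : ι → ℝ) :
    ∫ z, (∑ i, α i * z i) * (∑ i, β i * z i) ∂whiteNoise ι = ∑ i, α i * β i := by
  classical
  have hint : ∀ i j, Integrable (fun z : ι → ℝ => α i * z i * (β j * z j)) (whiteNoise ι) :=
    fun i j => ((memLp_coord i).const_mul _).integrable_mul ((memLp_coord j).const_mul _)
  simp_rw [Finset.sum_mul_sum]
  rw [integral_finsetSum _ fun i _ => integrable_finsetSum _ fun j _ => hint i j]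
  refine Finset.sum_congr rfl fun i _ => ?_
  rw [integral_finsetSum _ fun j _ => hint i j]
  have : ∀ j, ∫ z, α i * z i * (β j * z j) ∂whiteNoise ι =
      α i * β j * if i = j then 1 else 0 := fun j => by
    rw [← integral_coord_mul, ← integral_const_mul]
    exact integral_congr_ae (Filter.Eventually.of_forall fun z => by ring)
  simp [this]

section Hilbert

variable {H : Type*} [NormedAddCommGroup H] [InnerProductSpace ℝ H] {ι : Type*} [Fintype ι]

/-- The synthesis map `z ↦ ∑ zᵢ fᵢ` of a finite family of vectors. -/
noncomputable def synth (f : ι → H) : (ι → ℝ) →L[ℝ] H :=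
  ∑ i, (ContinuousLinearMap.proj i : (ι → ℝ) →L[ℝ] ℝ).smulRight (f i)

theorem synth_apply (f : ι → H) (z : ι → ℝ) : synth f z = ∑ i, z i • f i := by
  simp [synth]

/-- The finite-rank operator `∑ fᵢ ⊗ fᵢ`. -/
noncomputable def covOp (f : ι → H) : H →L[ℝ] H :=
  ∑ i, (innerSL ℝ (f i)).smulRight (f i)

theorem covOp_apply (f : ι → H) (ψ : H) : covOp f ψ = ∑ i, ⟪f i, ψ⟫ • f i := by
  simp [covOp]

theorem inner_covOp (f : ι → H) (ψ φ : H) : ⟪covOp f ψ, φ⟫ = ∑ i, ⟪f i, ψ⟫ * ⟪f i, φ⟫ := by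
  simp [covOp_apply, sum_inner, real_inner_smul_left]

/-- The quadratic form of `∑ fᵢ ⊗ fᵢ` at a unit vector dominates each of its terms. -/
theorem sq_le_norm_covOp (f : ι → H) {u : H} (hu : ‖u‖ = 1) (i : ι) :
    ⟪f i, u⟫ ^ 2 ≤ ‖covOp f‖ := by
  have h1 : ⟪covOp f u, u⟫ ≤ ‖covOp f‖ := by
    have h := real_inner_le_norm (covOp f u) u
    have h' := (covOp f).le_opNorm u
    rw [hu, mul_one] at h h'
    exact h.trans h'
  refine le_trans ?_ h1
  rw [inner_covOp, sq]
  exact Finset.single_le_sum (f := fun k => ⟪f k, u⟫ * ⟪f k, u⟫)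
    (fun k _ => mul_self_nonneg _) (Finset.mem_univ i)

/-- If the synthesis map is bounded by `K` in the Euclidean norm of the coefficients, then
`‖∑ fᵢ ⊗ fᵢ‖ ≤ K²`: the operator factors as synthesis after its adjoint. -/
theorem norm_covOp_le (f : ι → H) {K : ℝ} (hK : 0 ≤ K)
    (h : ∀ c : ι → ℝ, ‖∑ i, c i • f i‖ ≤ K * √(∑ i, c i ^ 2)) : ‖covOp f‖ ≤ K ^ 2 := by
  refine ContinuousLinearMap.opNorm_le_bound _ (sq_nonneg K) fun ψ => ?_
  have h1 := h fun i => ⟪f i, ψ⟫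
  set c := √(∑ i, ⟪f i, ψ⟫ ^ 2) with hc
  have hc0 : 0 ≤ c := Real.sqrt_nonneg _
  have h2 : c ^ 2 = ⟪covOp f ψ, ψ⟫ := by
    rw [hc, Real.sq_sqrt (Finset.sum_nonneg fun i _ => sq_nonneg _), inner_covOp]
    exact Finset.sum_congr rfl fun i _ => sq _
  rw [← covOp_apply] at h1
  have h3 := real_inner_le_norm (covOp f ψ) ψ
  have h4 : c ≤ K * ‖ψ‖ := by
    rcases hc0.eq_or_lt with h0 | h0
    · rw [← h0]; positivity
    · refine le_of_mul_le_mul_left ?_ h0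
      nlinarith [norm_nonneg ψ]
  calc ‖covOp f ψ‖ ≤ K * c := h1
    _ ≤ K * (K * ‖ψ‖) := by gcongr
    _ = K ^ 2 * ‖ψ‖ := by ring

variable [MeasurableSpace H] [BorelSpace H]

/-- The law of the Gaussian vector `∑ zᵢ fᵢ` with independent standard Gaussian coefficients. -/
noncomputable def gaussLaw (f : ι → H) : Measure H := (whiteNoise ι).map (synth f)

instance isProbabilityMeasure_gaussLaw (f : ι → H) : IsProbabilityMeasure (gaussLaw f) :=
  Measure.isProbabilityMeasure_map (synth f).continuous.aemeasurable

instance isGaussian_gaussLaw (f : ι → H) : IsGaussian (gaussLaw f) := by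
  have : IsGaussian (whiteNoise ι) := by
    have h := map_pi_eq_stdGaussian (ι := ι)
    have h' : whiteNoise ι =
        (stdGaussian (EuclideanSpace ℝ ι)).map (EuclideanSpace.equiv ι ℝ) := by
      rw [← h, Measure.map_map (by fun_prop) (by fun_prop)]
      exact Measure.map_id.symm
    rw [h']
    infer_instance
  unfold gaussLaw
  infer_instance

theorem integral_gaussLaw [SecondCountableTopology H] [CompleteSpace H] (f : ι → H) :
    ∫ u, u ∂gaussLaw f = 0 := by
  unfold gaussLaw
  rw [integral_map (synth f).continuous.aemeasurable (by fun_prop)]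
  simp_rw [synth_apply]
  rw [integral_finsetSum _ fun i _ => ((memLp_coord i).integrable one_le_two).smul_const _]
  simp [integral_smul_const, integral_coord]

theorem covarianceOperator_gaussLaw [SecondCountableTopology H] [CompleteSpace H] (f : ι → H) :
    covarianceOperator (gaussLaw f) = covOp f := by
  have hmem : MemLp id 2 (gaussLaw f) := IsGaussian.memLp_two_id
  ext1 x
  refine ext_inner_right ℝ fun y => ?_
  rw [covarianceOperator_inner hmem, inner_covOp]
  unfold gaussLaw
  rw [integral_map (synth f).continuous.aemeasurable (by fun_prop)]
  rw [← integral_linear_mul_linear (fun i => ⟪f i, x⟫) fun i => ⟪f i, y⟫]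
  refine integral_congr_ae (Filter.Eventually.of_forall fun z => ?_)
  simp only [synth_apply, inner_sum, real_inner_smul_right]
  congr 1 <;> exact Finset.sum_congr rfl fun i _ => by rw [real_inner_comm, mul_comm]

end Hilbert

-- Instance search alone exceeds its size limit on the separability of the measure.
instance (d : ℕ) : SecondCountableTopology (L2 d) :=
  haveI : Fact ((2 : ℝ≥0∞) ≠ ∞) := ⟨by simp⟩
  haveI : IsSeparable (volume : Measure (Cube d)) :=
    @instIsSeparableOfCountablyGeneratedOfSFinite _ _ _ inferInstance inferInstance
  Lp.SecondCountableTopology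

theorem isGP_gaussLaw {d : ℕ} {ι : Type*} [Fintype ι] (f : ι → L2 d) :
    IsGP (gaussLaw f) (covOp f) where
  isGaussian := inferInstance
  mean_eq_zero := integral_gaussLaw f
  covariance_eq := covarianceOperator_gaussLaw f

/-- Risk lower bound from a measurable minorant of the loss, with the data expressed through white
noise. -/
theorem le_relRisk {d N : ℕ} {ι : Type*} [Fintype ι] (f : ι → L2 d)
    (T : (Fin N → L2 d) → (L2 d →L[ℝ] L2 d)) {K : ℝ} (hK : ‖covOp f‖ ≤ K)
    (G : (Fin N → L2 d) → ℝ≥0∞) (hG : Measurable G) (hle : ∀ U, G U ≤ ‖T U - covOp f‖ₑ) :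
    (∫⁻ z, G (fun n => synth f (z n)) ∂noiseSample N ι) / ENNReal.ofReal K ≤
      relRisk T (covOp f) (gaussLaw f) := by
  have hmap : Measure.pi (fun _ : Fin N => gaussLaw f) =
      (noiseSample N ι).map fun z n => synth f (z n) :=
    (Measure.pi_map_pi fun _ => (synth f).continuous.aemeasurable).symm
  have hS : Measurable fun (z : Fin N → ι → ℝ) n => synth f (z n) :=
    measurable_pi_lambda _ fun n => (synth f).continuous.measurable.comp (measurable_pi_apply n)
  unfold relRisk
  refine ENNReal.div_le_div ?_ ?_
  · rw [hmap]
    calc _ = ∫⁻ U, G U ∂(noiseSample N ι).map fun z n => synth f (z n) :=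
          (lintegral_map hG hS).symm
      _ ≤ _ := lintegral_mono hle
  · rw [← ofReal_norm]
    exact ENNReal.ofReal_le_ofReal hK

theorem relRisk_le_iSup {d N : ℕ} {ι : Type*} [Fintype ι] {F : Set (L2 d →L[ℝ] L2 d)} (f : ι → L2 d)
    (hf : covOp f ∈ F) (T : (Fin N → L2 d) → (L2 d →L[ℝ] L2 d)) :
    relRisk T (covOp f) (gaussLaw f) ≤
      ⨆ (C ∈ F) (μ : Measure (L2 d)) (_ : IsGP μ C), relRisk T C μ :=
  le_iSup₂_of_le (covOp f) hf <| le_iSup₂_of_le (gaussLaw f) (isGP_gaussLaw f) le_rfl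

/-! ### Finite-rank integral operators and their trace -/

section Kernel

variable {d : ℕ} {ι : Type*} [Fintype ι]

theorem isCovarianceFunction_sum_mul {F : ι → Cube d → ℝ} (hF : ∀ k, Measurable (F k)) :
    IsCovarianceFunction fun x y => ∑ k, F k x * F k y where
  measurable := by
    refine Finset.measurable_sum _ fun k _ => ?_
    exact ((hF k).comp measurable_fst).mul ((hF k).comp measurable_snd)
  posSemidef n x := by
    convert Matrix.posSemidef_conjTranspose_mul_self (Matrix.of fun k i => F k (x i)) using 1
    ext i j
    simp [Matrix.mul_apply]

theorem isIntegralOperator_covOp {f : ι → L2 d} {F : ι → Cube d → ℝ}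
    (hf : ∀ k, f k =ᵐ[volume] F k) :
    IsIntegralOperator (covOp f) fun x y => ∑ k, F k x * F k y := by
  intro ψ
  have h1 : ∀ k, ⟪f k, ψ⟫ = ∫ y, F k y * ψ y := fun k => by
    rw [L2.inner_def]
    refine integral_congr_ae ((hf k).mono fun y hy => ?_)
    simp [hy, mul_comm]
  have hint : ∀ k, Integrable (fun y => F k y * ψ y) volume := fun k =>
    (L2.integrable_inner (𝕜 := ℝ) (f k) ψ).congr <| (hf k).mono fun y hy => by
      simp [hy, mul_comm]
  have h2 : ∀ x, ∫ y, (∑ k, F k x * F k y) * ψ y = ∑ k, F k x * ⟪f k, ψ⟫ := fun x => by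
    simp_rw [Finset.sum_mul, h1, mul_assoc]
    rw [integral_finsetSum _ fun k _ => (hint k).const_mul _]
    exact Finset.sum_congr rfl fun k _ => integral_const_mul _ _
  have h3 : ⇑(covOp f ψ) =ᵐ[volume] fun x => ∑ k, ⟪f k, ψ⟫ * f k x := by
    rw [covOp_apply]
    refine (Lp.coeFn_finsetSum _ _).trans ?_
    have : ∀ᵐ x ∂(volume : Measure (Cube d)), ∀ k, (⟪f k, ψ⟫ • f k : L2 d) x = ⟪f k, ψ⟫ * f k x :=
      ae_all_iff.2 fun k => Lp.coeFn_smul _ _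
    exact this.mono fun x hx => by rw [Finset.sum_apply]; exact Finset.sum_congr rfl fun k _ => hx k
  filter_upwards [h3, ae_all_iff.2 hf] with x hx hx'
  rw [hx, h2]
  exact Finset.sum_congr rfl fun k _ => by rw [hx' k, mul_comm]

/-- By Bessel's inequality, the trace of `∑ fₖ ⊗ fₖ` is at most `∑ ‖fₖ‖²`. -/
theorem opTrace_covOp_le (f : ι → L2 d) :
    opTrace (covOp f) ≤ ENNReal.ofReal (∑ k, ‖f k‖ ^ 2) := by
  refine iSup_le fun n => iSup₂_le fun e he => ?_
  have hnn : ∀ i, 0 ≤ ⟪covOp f (e i), e i⟫ := fun i => by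
    rw [inner_covOp]; exact Finset.sum_nonneg fun k _ => mul_self_nonneg _
  rw [← ENNReal.ofReal_sum_of_nonneg fun i _ => hnn i]
  refine ENNReal.ofReal_le_ofReal ?_
  simp_rw [inner_covOp]
  rw [Finset.sum_comm]
  refine Finset.sum_le_sum fun k _ => ?_
  refine le_trans (le_of_eq ?_) (he.sum_inner_products_le (f k) (s := Finset.univ))
  refine Finset.sum_congr rfl fun i _ => ?_
  rw [Real.norm_eq_abs, sq_abs, real_inner_comm, sq]

theorem le_opTrace (C : L2 d →L[ℝ] L2 d) {e : ι → L2 d} (he : Orthonormal ℝ e)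
    (hnn : ∀ i, 0 ≤ ⟪C (e i), e i⟫) :
    ENNReal.ofReal (∑ i, ⟪C (e i), e i⟫) ≤ opTrace C := by
  let E := Fintype.equivFin ι
  refine le_iSup_of_le (Fintype.card ι) <|
    le_iSup₂_of_le (e ∘ E.symm) (he.comp _ E.symm.injective) ?_
  rw [ENNReal.ofReal_sum_of_nonneg fun i _ => hnn i]
  exact (Equiv.sum_comp E.symm fun i => ENNReal.ofReal ⟪C (e i), e i⟫).ge

end Kernel

/-! ### Piecewise constant kernels on a family of cells -/

/-- A finite family of disjoint measurable cells of the same volume `v` in the cube. -/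
structure CellFamily (d : ℕ) (ι : Type*) (v : ℝ) where
  /-- the cells -/
  cell : ι → Set (Cube d)
  measurableSet : ∀ i, MeasurableSet (cell i)
  disjoint : ∀ i j, i ≠ j → Disjoint (cell i) (cell j)
  volume_cell : ∀ i, volume (cell i) = ENNReal.ofReal v
  pos : 0 < v

/-- The Gram matrix `βᵀ β` of the columns of `β`. -/
def gram {ι : Type*} [Fintype ι] (β : ι → ι → ℝ) (i j : ι) : ℝ := ∑ k, β k i * β k j

namespace CellFamily

variable {d : ℕ} {ι : Type*} {v : ℝ} (S : CellFamily d ι v)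

/-- The normalised indicator function of a cell. -/
noncomputable def cellFun (i : ι) : Cube d → ℝ := (S.cell i).indicator fun _ => (√v)⁻¹

/-- The normalised indicator function of a cell, as an element of `L²`. -/
noncomputable def cellVec (i : ι) : L2 d :=
  indicatorConstLp 2 (S.measurableSet i) (by rw [S.volume_cell]; simp) (√v)⁻¹

theorem cellVec_ae (i : ι) : S.cellVec i =ᵐ[volume] S.cellFun i := indicatorConstLp_coeFn

theorem measurable_cellFun (i : ι) : Measurable (S.cellFun i) :=
  measurable_const.indicator (S.measurableSet i)

theorem orthonormal_cellVec : Orthonormal ℝ S.cellVec := by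
  classical
  have hv := S.pos
  rw [orthonormal_iff_ite]
  intro i j
  unfold cellVec
  rw [L2.inner_indicatorConstLp_indicatorConstLp]
  split_ifs with h
  · subst h
    rw [Set.inter_self, measureReal_def, S.volume_cell, ENNReal.toReal_ofReal hv.le]
    simp only [real_inner_self_eq_norm_sq, Real.norm_eq_abs, sq_abs, inv_pow, Real.sq_sqrt hv.le]
    simp [hv.ne']
  · rw [(S.disjoint i j h).inter_eq]
    simp

/-- Bessel's inequality and Cauchy-Schwarz: an operator is at least as large as the normalised
`ℓ¹` norm of the coordinates of one of its values. -/
theorem sum_abs_le_enorm (A C : L2 d →L[ℝ] L2 d) {u : L2 d} (hu : ‖u‖ = 1)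
    {B : Finset ι} (hB : 0 < B.card) :
    ENNReal.ofReal (√B.card)⁻¹ * ∑ i ∈ B, ENNReal.ofReal |⟪A u, S.cellVec i⟫ - ⟪C u, S.cellVec i⟫|
      ≤ ‖A - C‖ₑ := by
  have hBpos : (0 : ℝ) < B.card := by exact_mod_cast hB
  rw [← ENNReal.ofReal_sum_of_nonneg fun i _ => abs_nonneg _, ← ENNReal.ofReal_mul (by positivity),
    ← ofReal_norm]
  refine ENNReal.ofReal_le_ofReal ?_
  rw [inv_mul_le_iff₀ (Real.sqrt_pos.2 hBpos)]
  set x := (A - C) u with hx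
  have h1 : ∀ i, ⟪A u, S.cellVec i⟫ - ⟪C u, S.cellVec i⟫ = ⟪S.cellVec i, x⟫ := fun i => by
    rw [hx, sub_apply, inner_sub_right, real_inner_comm, real_inner_comm (C u)]
  simp_rw [h1]
  have h2 : ‖x‖ ≤ ‖A - C‖ := by
    have := (A - C).le_opNorm u
    rwa [hu, mul_one] at this
  have h3 : (∑ i ∈ B, |⟪S.cellVec i, x⟫|) ^ 2 ≤ (√B.card * ‖x‖) ^ 2 := by
    rw [mul_pow, Real.sq_sqrt hBpos.le]
    refine (sq_sum_le_card_mul_sum_sq).trans ?_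
    gcongr
    exact S.orthonormal_cellVec.sum_inner_products_le x
  calc _ ≤ √B.card * ‖x‖ := abs_le_of_sq_le_sq' h3 (by positivity) |>.2
    _ ≤ _ := by gcongr

variable [Fintype ι]

theorem sum_cellFun {i : ι} {x : Cube d} (hx : x ∈ S.cell i) (b : ι → ℝ) :
    ∑ j, b j * S.cellFun j x = b i * (√v)⁻¹ := by
  rw [Finset.sum_eq_single i]
  · simp [cellFun, hx]
  · intro j _ hj
    have : x ∉ S.cell j := fun h => Set.disjoint_left.1 (S.disjoint j i hj) h hx
    simp [cellFun, this]
  · simp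

theorem sum_cellFun_eq_zero {x : Cube d} (hx : ∀ i, x ∉ S.cell i) (b : ι → ℝ) :
    ∑ j, b j * S.cellFun j x = 0 :=
  Finset.sum_eq_zero fun j _ => by simp [cellFun, hx j]

/-- The function with coefficients `b` in the normalised indicators. -/
noncomputable def combine (b : ι → ℝ) : L2 d := ∑ i, b i • S.cellVec i

theorem combine_ae (b : ι → ℝ) :
    S.combine b =ᵐ[volume] fun x => ∑ j, b j * S.cellFun j x := by
  unfold combine
  refine (Lp.coeFn_finsetSum _ _).trans ?_
  have h1 : ∀ᵐ x ∂(volume : Measure (Cube d)), ∀ k, (b k • S.cellVec k : L2 d) x =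
      b k * S.cellVec k x := ae_all_iff.2 fun k => Lp.coeFn_smul _ _
  filter_upwards [h1, ae_all_iff.2 S.cellVec_ae] with x hx hx'
  rw [Finset.sum_apply]
  exact Finset.sum_congr rfl fun k _ => (hx k).trans (by rw [hx' k])

theorem inner_combine_cellVec (b : ι → ℝ) (i : ι) : ⟪S.combine b, S.cellVec i⟫ = b i := by
  unfold combine
  simp [S.orthonormal_cellVec.inner_left_fintype]

theorem norm_combine_sq (b : ι → ℝ) : ‖S.combine b‖ ^ 2 = ∑ i, b i ^ 2 := by
  rw [← real_inner_self_eq_norm_sq]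
  conv_lhs => rw [combine]
  rw [S.orthonormal_cellVec.inner_sum]
  simp [sq]

theorem norm_combine (b : ι → ℝ) : ‖S.combine b‖ = √(∑ i, b i ^ 2) := by
  rw [← norm_combine_sq, Real.sqrt_sq (norm_nonneg _)]

theorem inner_combine (b c : ι → ℝ) : ⟪S.combine b, S.combine c⟫ = ∑ i, b i * c i := by
  conv_lhs => rw [combine, combine]
  rw [S.orthonormal_cellVec.inner_sum]
  simp

/-- The covariance function with matrix `βᵀ β` in the normalised indicators. -/
noncomputable def kernel (β : ι → ι → ℝ) (x y : Cube d) : ℝ :=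
  ∑ k, (∑ j, β k j * S.cellFun j x) * ∑ j, β k j * S.cellFun j y

theorem kernel_eq (β : ι → ι → ℝ) {i j : ι} {x y : Cube d} (hx : x ∈ S.cell i)
    (hy : y ∈ S.cell j) : S.kernel β x y = v⁻¹ * gram β i j := by
  have hv := S.pos
  have h : (√v)⁻¹ * (√v)⁻¹ = v⁻¹ := by rw [← mul_inv, Real.mul_self_sqrt hv.le]
  simp_rw [kernel, gram, S.sum_cellFun hx, S.sum_cellFun hy, Finset.mul_sum, ← h]
  exact Finset.sum_congr rfl fun k _ => by ring

theorem kernel_eq_zero_left (β : ι → ι → ℝ) {x y : Cube d} (hx : ∀ i, x ∉ S.cell i) :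
    S.kernel β x y = 0 :=
  Finset.sum_eq_zero fun k _ => by rw [S.sum_cellFun_eq_zero hx, zero_mul]

theorem kernel_eq_zero_right (β : ι → ι → ℝ) {x y : Cube d} (hy : ∀ i, y ∉ S.cell i) :
    S.kernel β x y = 0 :=
  Finset.sum_eq_zero fun k _ => by rw [S.sum_cellFun_eq_zero hy, mul_zero]

theorem measurable_euclDist_right (x : Cube d) : Measurable fun y : Cube d => euclDist x y := by
  unfold euclDist; fun_prop

/-- The off-diagonal tail of the kernel is at most an off-diagonal row sum of the Gram matrix. -/
theorem setIntegral_kernel_le [DecidableEq ι] (β : ι → ι → ℝ) {i : ι} {x : Cube d}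
    (hx : x ∈ S.cell i) {ρ : ℝ} (hcell : ∀ y ∈ S.cell i, euclDist x y ≤ ρ) :
    ∫ y in {y | ρ < euclDist x y}, |S.kernel β x y| ≤
      ∑ j ∈ Finset.univ.erase i, |gram β i j| := by
  have hv := S.pos
  have hA : MeasurableSet {y | ρ < euclDist x y} :=
    measurableSet_lt measurable_const (measurable_euclDist_right x)
  set g : Cube d → ℝ := fun y =>
    ∑ j ∈ Finset.univ.erase i, (S.cell j).indicator (fun _ => v⁻¹ * |gram β i j|) y with hg
  have hgi : ∀ j, Integrable ((S.cell j).indicator fun _ => v⁻¹ * |gram β i j|)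
      (volume : Measure (Cube d)) := fun j =>
    (integrable_indicator_iff (S.measurableSet j)).2 <|
      integrableOn_const (by rw [S.volume_cell]; simp)
  have hgint : Integrable g volume := integrable_finsetSum _ fun j _ => hgi j
  have hnn : ∀ j y, 0 ≤ (S.cell j).indicator (fun _ => v⁻¹ * |gram β i j|) y := fun j y =>
    Set.indicator_nonneg (fun _ _ => by positivity) y
  have hg0 : ∀ y, 0 ≤ g y := fun y => Finset.sum_nonneg fun j _ => hnn j y
  have hle : ∀ y ∈ {y | ρ < euclDist x y}, |S.kernel β x y| ≤ g y := by
    intro y hy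
    by_cases hyc : ∃ j, y ∈ S.cell j
    · obtain ⟨j, hj⟩ := hyc
      -- points of the cell of `x` are too close to contribute
      have hji : j ≠ i := by
        rintro rfl
        exact absurd (hcell y hj) (not_le.2 hy)
      rw [S.kernel_eq β hx hj, abs_mul, abs_of_pos (inv_pos.2 hv)]
      refine le_trans (le_of_eq ?_) (Finset.single_le_sum (fun j _ => hnn j y)
        (Finset.mem_erase.2 ⟨hji, Finset.mem_univ j⟩))
      rw [Set.indicator_of_mem hj]
    · push Not at hyc
      rw [S.kernel_eq_zero_right β hyc, abs_zero]
      exact hg0 y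
  calc ∫ y in {y | ρ < euclDist x y}, |S.kernel β x y|
      ≤ ∫ y in {y | ρ < euclDist x y}, g y :=
        integral_mono_of_nonneg (Filter.Eventually.of_forall fun y => abs_nonneg _)
          hgint.integrableOn ((ae_restrict_iff' hA).2 (Filter.Eventually.of_forall hle))
    _ ≤ ∫ y, g y := setIntegral_le_integral hgint (Filter.Eventually.of_forall hg0)
    _ = ∑ j ∈ Finset.univ.erase i, |gram β i j| := by
        rw [hg, integral_finsetSum _ fun j _ => hgi j]
        refine Finset.sum_congr rfl fun j _ => ?_
        rw [integral_indicator_const _ (S.measurableSet j), measureReal_def, S.volume_cell,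
          ENNReal.toReal_ofReal hv.le, smul_eq_mul, mul_inv_cancel_left₀ hv.ne']

/-- Membership in the banded class of the operator with matrix `βᵀ β` in the normalised indicators
of a family of cells: the cells have diameter at most `r^{-1/d}`, and the off-diagonal entries are
confined to cells at mutual distance at most `m r^{-1/d}`, with row sums at most `c₂ ν_m`. -/
theorem covOp_mem_bandedClass [Nonempty ι] [DecidableEq ι] (β : ι → ι → ℝ) {c₁ c₂ r : ℝ}
    {ν : ℕ+ → ℝ} (hc₂ : 0 < c₂) (hνpos : ∀ m, 0 < ν m) (hν : Antitone ν)
    (hnorm : 1 ≤ ‖covOp fun k => S.combine (β k)‖)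
    (htr : ∑ k, ∑ i, β k i ^ 2 ≤ r * ‖covOp fun k => S.combine (β k)‖)
    (hdiag : ∀ i, 1 ≤ gram β i i) (hdiag' : ∀ i, gram β i i ≤ 2)
    (hc₁ : 0 ≤ c₁) (hcard : v⁻¹ * 2 ≤ c₁ * Fintype.card ι)
    (hcell : ∀ i, ∀ x ∈ S.cell i, ∀ y ∈ S.cell i, euclDist x y ≤ r ^ (-(1 / d : ℝ)))
    (m : ℕ+) (hloc : ∀ i j, i ≠ j → gram β i j ≠ 0 → ∀ x ∈ S.cell i, ∀ y ∈ S.cell j,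
      euclDist x y ≤ m * r ^ (-(1 / d : ℝ)))
    (hrow : ∀ i, ∑ j ∈ Finset.univ.erase i, |gram β i j| ≤ c₂ * ν m) :
    (covOp fun k => S.combine (β k)) ∈ bandedClass d c₁ c₂ r ν := by
  have hv := S.pos
  set C := covOp fun k => S.combine (β k) with hC
  have hup : opTrace C ≤ ENNReal.ofReal (∑ k, ∑ i, β k i ^ 2) := by
    refine (opTrace_covOp_le _).trans (le_of_eq ?_)
    simp_rw [S.norm_combine_sq]
  have hfin : opTrace C ≠ ∞ := ne_top_of_le_ne_top ENNReal.ofReal_ne_top hup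
  have hinner : ∀ i, ⟪C (S.cellVec i), S.cellVec i⟫ = gram β i i := fun i => by
    rw [hC, inner_covOp]
    simp_rw [S.inner_combine_cellVec]
    rfl
  have hlow : (Fintype.card ι : ℝ) ≤ (opTrace C).toReal := by
    have h := le_opTrace C S.orthonormal_cellVec fun i => by
      rw [hinner]; linarith [hdiag i]
    have h' : (Fintype.card ι : ℝ) ≤ ∑ i, ⟪C (S.cellVec i), S.cellVec i⟫ := by
      simp_rw [hinner]
      calc (Fintype.card ι : ℝ) = ∑ _i : ι, (1 : ℝ) := by simp
        _ ≤ _ := Finset.sum_le_sum fun i _ => hdiag i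
    rw [ENNReal.ofReal_le_iff_le_toReal hfin] at h
    exact h'.trans h
  have hupr : (opTrace C).toReal ≤ r * ‖C‖ :=
    (ENNReal.toReal_le_of_le_ofReal (Finset.sum_nonneg fun k _ =>
      Finset.sum_nonneg fun i _ => sq_nonneg _) hup).trans htr
  have hcpos : (0 : ℝ) < Fintype.card ι := by exact_mod_cast Fintype.card_pos
  have heff : effDim C ≤ r := by
    rw [effDim, div_le_iff₀ (by linarith)]; exact hupr
  have heff0 : 0 < effDim C := div_pos (hcpos.trans_le hlow) (by linarith)
  set ρ := r ^ (-(1 / d : ℝ)) with hρ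
  have hρle : ρ ≤ effDim C ^ (-(1 / d : ℝ)) :=
    Real.rpow_le_rpow_of_nonpos heff0 heff (by simp)
  have hρ0 : 0 ≤ ρ := Real.rpow_nonneg (heff0.le.trans heff) _
  refine ⟨fun h => ?_, hfin, heff, S.kernel β, ?_, ?_, fun x => ?_, fun m' x => ?_⟩
  · rw [h, norm_zero] at hnorm; linarith
  · exact isCovarianceFunction_sum_mul (F := fun k x => ∑ j, β k j * S.cellFun j x) fun k =>
      Finset.measurable_sum _ fun j _ => (S.measurable_cellFun j).const_mul _
  · exact isIntegralOperator_covOp fun k => S.combine_ae (β k)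
  · by_cases hx : ∃ i, x ∈ S.cell i
    · obtain ⟨i, hi⟩ := hx
      rw [S.kernel_eq β hi hi]
      calc v⁻¹ * gram β i i ≤ v⁻¹ * 2 := by gcongr; exact hdiag' i
        _ ≤ c₁ * Fintype.card ι := hcard
        _ ≤ _ := by gcongr
    · push Not at hx
      rw [S.kernel_eq_zero_left β hx]
      positivity
  · have hrhs : 0 ≤ c₂ * ‖C‖ * ν m' := by have := hνpos m'; positivity
    have hm' : (1 : ℝ) ≤ m' := by exact_mod_cast one_le (a := m')
    by_cases hx : ∃ i, x ∈ S.cell i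
    swap
    · push Not at hx
      simp_rw [S.kernel_eq_zero_left β hx]
      simpa using hrhs
    obtain ⟨i, hi⟩ := hx
    have hrad : ρ ≤ m' * effDim C ^ (-(1 / d : ℝ)) := by
      calc ρ ≤ 1 * effDim C ^ (-(1 / d : ℝ)) := by rw [one_mul]; exact hρle
        _ ≤ _ := by gcongr
    rcases le_or_gt m m' with hmm | hmm
    · -- beyond radius `m` the kernel vanishes
      have hz : ∀ y ∈ {y | (m' : ℝ) * effDim C ^ (-(1 / d : ℝ)) < euclDist x y},
          |S.kernel β x y| = 0 := by
        intro y hy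
        by_cases hyc : ∃ j, y ∈ S.cell j
        · obtain ⟨j, hj⟩ := hyc
          rw [S.kernel_eq β hi hj]
          by_cases hij : i = j
          · subst hij
            exact absurd ((hcell i x hi y hj).trans hrad) (not_le.2 hy)
          · by_cases hg : gram β i j = 0
            · simp [hg]
            · refine absurd ((hloc i j hij hg x hi y hj).trans ?_) (not_le.2 hy)
              have : (m : ℝ) ≤ m' := by exact_mod_cast hmm
              gcongr
        · push Not at hyc
          rw [S.kernel_eq_zero_right β hyc, abs_zero]
      rw [setIntegral_eq_zero_of_forall_eq_zero hz]
      exact hrhs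
    · calc _ ≤ ∑ j ∈ Finset.univ.erase i, |gram β i j| :=
            S.setIntegral_kernel_le β hi fun y hy => (hcell i x hi y hy).trans hrad
        _ ≤ c₂ * ν m := hrow i
        _ ≤ c₂ * ν m' := by gcongr; exact hν hmm.le
        _ ≤ c₂ * ‖C‖ * ν m' := by
            have := hνpos m'
            gcongr
            exact le_mul_of_one_le_right hc₂.le hnorm

end CellFamily

/-! ### Cells of a grid -/

/-- The cell `∏ [κᵢ / n, (κᵢ + 1) / n)` of the grid of mesh `1 / n`. -/
def gridCell (d n : ℕ) (κ : Fin d → Fin n) : Set (Cube d) :=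
  Set.univ.pi fun t =>
    {s : unitInterval | (κ t : ℝ) / n ≤ (s : ℝ) ∧ (s : ℝ) < ((κ t : ℝ) + 1) / n}

/-- A family of distinct cells of the grid of mesh `1 / n`. -/
def gridFamily (d n : ℕ) (hn : 0 < n) {ι : Type*} (κ : ι → Fin d → Fin n)
    (hκ : Function.Injective κ) : CellFamily d ι ((n : ℝ) ^ d)⁻¹ where
  cell i := gridCell d n (κ i)
  measurableSet i := MeasurableSet.univ_pi fun t =>
    (measurableSet_le measurable_const measurable_subtype_coe).inter
      (measurableSet_lt measurable_subtype_coe measurable_const)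
  disjoint i j hij := by
    have hn' : (0 : ℝ) < n := by exact_mod_cast hn
    rw [Set.disjoint_left]
    intro x hx hy
    refine hij (hκ (funext fun t => ?_))
    obtain ⟨h1, h2⟩ := hx t trivial
    obtain ⟨h3, h4⟩ := hy t trivial
    have h5 := h1.trans_lt h4
    have h6 := h3.trans_lt h2
    rw [div_lt_div_iff_of_pos_right hn'] at h5 h6
    have h5' : (κ i t : ℕ) < κ j t + 1 := by exact_mod_cast h5
    have h6' : (κ j t : ℕ) < κ i t + 1 := by exact_mod_cast h6
    exact Fin.ext (by omega)
  volume_cell i := by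
    have hn' : (0 : ℝ) < n := by exact_mod_cast hn
    rw [gridCell, volume_pi_pi]
    have : ∀ t, volume {s : unitInterval | (κ i t : ℝ) / n ≤ (s : ℝ) ∧
        (s : ℝ) < ((κ i t : ℝ) + 1) / n} = ENNReal.ofReal (n : ℝ)⁻¹ := by
      intro t
      have h1 : ((κ i t : ℝ) + 1) ≤ n := by exact_mod_cast (κ i t).2
      let a : unitInterval := ⟨(κ i t : ℝ) / n, by positivity, by
        rw [div_le_one hn']; linarith⟩
      let b : unitInterval := ⟨((κ i t : ℝ) + 1) / n, by positivity, by
        rw [div_le_one hn']; linarith⟩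
      have : {s : unitInterval | (κ i t : ℝ) / n ≤ (s : ℝ) ∧ (s : ℝ) < ((κ i t : ℝ) + 1) / n} =
          Set.Ico a b := rfl
      rw [this, unitInterval.volume_Ico]
      congr 1
      simp only [a, b]
      field_simp
      ring
    simp_rw [this]
    rw [Finset.prod_const, Finset.card_univ, Fintype.card_fin, ← ENNReal.ofReal_pow (by positivity),
      inv_pow]
  pos := by positivity

theorem euclDist_le {d : ℕ} {x y : Cube d} {a : ℝ} (ha : 0 ≤ a)
    (h : ∀ t, |(x t : ℝ) - y t| ≤ a) : euclDist x y ≤ √d * a := by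
  unfold euclDist
  refine Real.sqrt_le_iff.2 ⟨by positivity, ?_⟩
  calc ∑ i, ((x i : ℝ) - y i) ^ 2 ≤ ∑ _i : Fin d, a ^ 2 :=
        Finset.sum_le_sum fun t _ => sq_le_sq' (abs_le.1 (h t)).1 (abs_le.1 (h t)).2
    _ = (√d * a) ^ 2 := by rw [mul_pow, Real.sq_sqrt (by positivity)]; simp

/-- On the grid of mesh `1 / n` with `n ≥ d r^{1/d}`, points whose coordinates differ by at most
`a` meshes are at Euclidean distance at most `a r^{-1/d}`. -/
theorem euclDist_grid_le {d n : ℕ} (hd : 1 ≤ d) {r : ℝ} (hr : 0 < r)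
    (hn : d * r ^ (1 / d : ℝ) ≤ n) {x y : Cube d} {a : ℝ} (ha : 0 ≤ a)
    (h : ∀ t, |(x t : ℝ) - y t| ≤ a / n) : euclDist x y ≤ a * r ^ (-(1 / d : ℝ)) := by
  have hd' : (1 : ℝ) ≤ d := by exact_mod_cast hd
  have hq : 0 < r ^ (1 / d : ℝ) := Real.rpow_pos_of_pos hr _
  have hn' : (0 : ℝ) < n := lt_of_lt_of_le (by positivity) hn
  refine (euclDist_le (by positivity) h).trans ?_
  rw [Real.rpow_neg hr.le, ← div_eq_mul_inv, mul_div_assoc', div_le_div_iff₀ hn' hq, mul_comm √_ a,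
    mul_assoc]
  refine mul_le_mul_of_nonneg_left (le_trans ?_ hn) ha
  gcongr
  exact Real.sqrt_le_iff.2 ⟨by positivity, by nlinarith⟩

theorem euclDist_gridCell_self_le {d n : ℕ} (hd : 1 ≤ d) {r : ℝ} (hr : 0 < r)
    (hn : d * r ^ (1 / d : ℝ) ≤ n) {κ : Fin d → Fin n} {x y : Cube d}
    (hx : x ∈ gridCell d n κ) (hy : y ∈ gridCell d n κ) :
    euclDist x y ≤ r ^ (-(1 / d : ℝ)) := by
  refine (euclDist_grid_le hd hr hn zero_le_one fun t => ?_).trans_eq (one_mul _)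
  obtain ⟨h1, h2⟩ := hx t trivial
  obtain ⟨h3, h4⟩ := hy t trivial
  rw [add_div] at h2 h4
  rw [abs_le]; constructor <;> linarith

theorem euclDist_gridCell_block_le {d n m : ℕ} (hd : 1 ≤ d) {r : ℝ} (hr : 0 < r)
    (hn : d * r ^ (1 / d : ℝ) ≤ n) {κ κ' : Fin d → Fin n} (hκ : ∀ t, (κ t : ℕ) < m)
    (hκ' : ∀ t, (κ' t : ℕ) < m) {x y : Cube d}
    (hx : x ∈ gridCell d n κ) (hy : y ∈ gridCell d n κ') :
    euclDist x y ≤ m * r ^ (-(1 / d : ℝ)) := by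
  refine euclDist_grid_le hd hr hn (Nat.cast_nonneg m) fun t => ?_
  obtain ⟨h1, h2⟩ := hx t trivial
  obtain ⟨h3, h4⟩ := hy t trivial
  have e1 : ((κ t : ℝ) + 1) / n ≤ (m : ℝ) / n := by
    gcongr; exact_mod_cast hκ t
  have e2 : ((κ' t : ℝ) + 1) / n ≤ (m : ℝ) / n := by
    gcongr; exact_mod_cast hκ' t
  have e3 : (0 : ℝ) ≤ (κ t : ℝ) / n := by positivity
  have e4 : (0 : ℝ) ≤ (κ' t : ℝ) / n := by positivity
  rw [abs_le]; constructor <;> linarith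

/-! ### Second moment of a mixture of variance changes -/

/-- A density `L` with second moment at most `4` keeps a fixed amount of mass below level `1`: two
hypotheses with likelihood ratio `L` cannot be told apart with small error. -/
theorem le_lintegral_min_one {α : Type*} [MeasurableSpace α] {μ : Measure α} {L : α → ℝ≥0∞}
    (hL : Measurable L) (h1 : ∫⁻ x, L x ∂μ = 1) (h2 : ∫⁻ x, L x * L x ∂μ ≤ 4) :
    ENNReal.ofReal (1 / 16) ≤ ∫⁻ x, min 1 (L x) ∂μ := by
  -- the part of `L` above level `8` is at most `L² / 8`, with integral at most `1 / 2`
  have hpt : ∀ x : ℝ≥0∞, x ≤ 8 * min 1 x + 8⁻¹ * (x * x) := by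
    intro x
    rcases le_total x 8 with h | h
    · refine le_trans ?_ le_self_add
      rcases le_total x 1 with h' | h'
      · rw [min_eq_right h']
        exact le_mul_of_one_le_left' (by norm_num)
      · rw [min_eq_left h', mul_one]; exact h
    · refine le_trans ?_ le_add_self
      calc x = 8⁻¹ * (8 * x) := by
            rw [← mul_assoc, ENNReal.inv_mul_cancel (by norm_num) (by norm_num), one_mul]
        _ ≤ _ := by gcongr
  have h3 : (1 : ℝ≥0∞) ≤ 8 * (∫⁻ x, min 1 (L x) ∂μ) + 8⁻¹ * 4 := by
    calc (1 : ℝ≥0∞) = ∫⁻ x, L x ∂μ := h1.symm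
      _ ≤ ∫⁻ x, 8 * min 1 (L x) + 8⁻¹ * (L x * L x) ∂μ := lintegral_mono fun x => hpt (L x)
      _ = 8 * (∫⁻ x, min 1 (L x) ∂μ) + 8⁻¹ * ∫⁻ x, L x * L x ∂μ := by
          rw [lintegral_add_left (by fun_prop), lintegral_const_mul _ (by fun_prop),
            lintegral_const_mul _ (by fun_prop)]
      _ ≤ _ := by gcongr
  set E := ∫⁻ x, min 1 (L x) ∂μ
  by_cases hE : E = ∞
  · rw [hE]; exact le_top
  rw [ENNReal.ofReal_le_iff_le_toReal hE]
  have h4 := ENNReal.toReal_mono (by finiteness) h3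
  rw [ENNReal.toReal_add (by finiteness) (by finiteness), ENNReal.toReal_mul,
    ENNReal.toReal_mul, ENNReal.toReal_inv] at h4
  norm_num at h4
  linarith

section Mixture

variable {N : ℕ} {ι : Type*}

/-- The likelihood ratio of `N` samples when coordinate `j` has variance `v` instead of `1`. -/
noncomputable def scaleLR (v : ℝ) (j : ι) (z : Fin N → ι → ℝ) : ℝ≥0∞ :=
  ∏ n, scaleDensity v (z n j)

@[fun_prop]
theorem measurable_scaleLR (v : ℝ) (j : ι) :
    Measurable (scaleLR v j : (Fin N → ι → ℝ) → ℝ≥0∞) := by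
  unfold scaleLR; fun_prop

variable [Fintype ι] [DecidableEq ι]

theorem lintegral_map_scale {v : ℝ} (hv : 0 < v) (j : ι) (G : (Fin N → ι → ℝ) → ℝ≥0∞)
    (hG : Measurable G) :
    ∫⁻ z, G (fun n => Function.update (z n) j (√v * z n j)) ∂noiseSample N ι =
      ∫⁻ z, G z * scaleLR v j z ∂noiseSample N ι :=
  lintegral_noiseSample_map (fun x => Function.update x j (√v * x j))
    (by
      rw [measurable_pi_iff]
      intro i
      by_cases hi : i = j
      · subst hi; simp only [Function.update_self]; fun_prop
      · simp only [Function.update_of_ne hi]; fun_prop)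
    (fun x => scaleDensity v (x j)) (by fun_prop) (whiteNoise_map_scale j hv) G hG

theorem lintegral_scaleLR {v : ℝ} (hv : 0 < v) (j : ι) :
    ∫⁻ z, scaleLR v j z ∂noiseSample N ι = 1 := by
  have := lintegral_map_scale (N := N) hv j (fun _ => 1) measurable_const
  simpa using this.symm

/-- Likelihood ratios for two different coordinates are uncorrelated. -/
theorem lintegral_scaleLR_mul {δ : ℝ} (h0 : 0 ≤ δ) (h1 : δ ^ 2 ≤ 1 / 2) (j k : ι) :
    ∫⁻ z, scaleLR (1 + δ) j z * scaleLR (1 + δ) k z ∂noiseSample N ι ≤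
      if j = k then ENNReal.ofReal (Real.exp (N * δ ^ 2)) else 1 := by
  have hv : 0 < 1 + δ := by linarith
  simp_rw [scaleLR, ← Finset.prod_mul_distrib]
  unfold noiseSample
  rw [lintegral_pi_prod (fun _ : Fin N => whiteNoise ι)
    (fun _ x => scaleDensity (1 + δ) (x j) * scaleDensity (1 + δ) (x k))
    fun _ => by fun_prop]
  rw [Finset.prod_const, Finset.card_univ, Fintype.card_fin]
  have hev : ∀ i (F : ℝ → ℝ≥0∞), Measurable F →
      ∫⁻ x : ι → ℝ, F (x i) ∂whiteNoise ι = ∫⁻ y, F y ∂gaussianReal 0 1 := fun i F hF =>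
    (measurePreserving_eval (fun _ : ι => gaussianReal 0 1) i).lintegral_comp hF
  split_ifs with h
  · subst h
    rw [hev j (fun y => scaleDensity (1 + δ) y * scaleDensity (1 + δ) y) (by fun_prop),
      Real.exp_nat_mul, ENNReal.ofReal_pow (Real.exp_pos _).le]
    gcongr
    exact lintegral_scaleDensity_sq h0 h1
  · have hind : iIndepFun (fun (_ : ι) (x : ι → ℝ) => scaleDensity (1 + δ) (x _))
        (whiteNoise ι) :=
      iIndepFun_pi (X := fun _ => scaleDensity (1 + δ)) fun i => by fun_prop
    have hm : ∀ i, Measurable fun x : ι → ℝ => scaleDensity (1 + δ) (x i) := fun i => by fun_prop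
    rw [lintegral_mul_eq_lintegral_mul_lintegral_of_indepFun'' (hm j).aemeasurable
      (hm k).aemeasurable (hind.indepFun h), hev j _ (by fun_prop), hev k _ (by fun_prop),
      lintegral_scaleDensity hv, one_mul, one_pow]

/-- The uniform mixture over all coordinates `j` of the laws with variance `1 + δ` in coordinate `j`
is hard to tell from white noise: its second moment is at most `1 + exp (N δ²) / card ι ≤ 4`. -/
theorem le_lintegral_min_mixture [Nonempty ι] {δ : ℝ} (h0 : 0 ≤ δ) (h1 : δ ^ 2 ≤ 1 / 2)
    (h2 : Real.exp (N * δ ^ 2) ≤ 3 * Fintype.card ι) :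
    ENNReal.ofReal (1 / 16) ≤ ∫⁻ z, min 1 (∑ j : ι, (Fintype.card ι : ℝ≥0∞)⁻¹ *
      scaleLR (1 + δ) j z) ∂noiseSample N ι := by
  have hv : 0 < 1 + δ := by linarith
  set R : ℝ≥0∞ := (Fintype.card ι : ℝ≥0∞) with hR
  have hR0 : R ≠ 0 := by simp [hR]
  have hRt : R ≠ ∞ := by simp [hR]
  refine le_lintegral_min_one (by fun_prop) ?_ ?_
  · rw [lintegral_finsetSum _ fun j _ => by fun_prop]
    simp_rw [lintegral_const_mul _ (measurable_scaleLR _ _), lintegral_scaleLR hv]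
    simp [← hR, ENNReal.mul_inv_cancel hR0 hRt]
  · simp_rw [← Finset.mul_sum, mul_mul_mul_comm, Finset.sum_mul_sum]
    rw [lintegral_const_mul _ (by fun_prop), lintegral_finsetSum _ fun j _ => by fun_prop]
    have hj : ∀ j : ι, ∫⁻ z, ∑ k, scaleLR (1 + δ) j z * scaleLR (1 + δ) k z ∂noiseSample N ι ≤
        3 * R + R := by
      intro j
      rw [lintegral_finsetSum _ fun k _ => by fun_prop]
      calc _ ≤ ∑ k, ((if j = k then ENNReal.ofReal (Real.exp (N * δ ^ 2)) else 0) + 1) := by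
            refine Finset.sum_le_sum fun k _ => (lintegral_scaleLR_mul h0 h1 j k).trans ?_
            split_ifs <;> simp
        _ = ENNReal.ofReal (Real.exp (N * δ ^ 2)) + R := by
            rw [Finset.sum_add_distrib]; simp [hR]
        _ ≤ 3 * R + R := by
            gcongr
            refine (ENNReal.ofReal_le_ofReal h2).trans (le_of_eq ?_)
            rw [ENNReal.ofReal_mul (by norm_num), ENNReal.ofReal_natCast]
            simp [hR]
    calc _ ≤ R⁻¹ * R⁻¹ * ∑ _j : ι, (3 * R + R) := by
          gcongr with j; exact hj j
      _ = 4 * ((R⁻¹ * R) * (R⁻¹ * R)) := by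
          rw [Finset.sum_const, Finset.card_univ, nsmul_eq_mul, ← hR]; ring
      _ = 4 := by rw [ENNReal.inv_mul_cancel hR0 hRt]; simp

end Mixture

/-! ### The logarithmic lower bound -/

theorem ofReal_abs_inner_sub_le {H : Type*} [NormedAddCommGroup H] [InnerProductSpace ℝ H]
    (A C : H →L[ℝ] H) {u w : H} (hu : ‖u‖ = 1) (hw : ‖w‖ = 1) :
    ENNReal.ofReal |⟪A u, w⟫ - ⟪C u, w⟫| ≤ ‖A - C‖ₑ := by
  rw [← ofReal_norm]
  refine ENNReal.ofReal_le_ofReal ?_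
  rw [← inner_sub_left, ← sub_apply]
  refine (abs_real_inner_le_norm _ _).trans ?_
  have := (A - C).le_opNorm u
  rw [hu, mul_one] at this
  rwa [hw, mul_one]

/-- The diagonal matrix with diagonal `a`. -/
def diagMat {ι : Type*} [DecidableEq ι] (a : ι → ℝ) (k i : ι) : ℝ := if k = i then a k else 0

section Diag

variable {d N : ℕ} {ι : Type*} [Fintype ι] [DecidableEq ι] {v : ℝ} (S : CellFamily d ι v)

theorem gram_diagMat (a : ι → ℝ) (i j : ι) :
    gram (diagMat a) i j = if i = j then a i ^ 2 else 0 := by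
  unfold gram diagMat
  split_ifs with h
  · subst h; simp [sq]
  · refine Finset.sum_eq_zero fun k _ => ?_
    by_cases hk : k = i
    · subst hk; simp [h]
    · simp [hk]

theorem CellFamily.combine_diagMat (a : ι → ℝ) (k : ι) :
    S.combine (diagMat a k) = a k • S.cellVec k := by
  simp [CellFamily.combine, diagMat]

/-- The covariance operator with variances `a²` in the normalised indicators. -/
noncomputable def CellFamily.diagOp (a : ι → ℝ) : L2 d →L[ℝ] L2 d :=
  covOp fun k => S.combine (diagMat a k)

theorem CellFamily.inner_diagOp (a : ι → ℝ) (i : ι) :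
    ⟪S.diagOp a (S.cellVec i), S.cellVec i⟫ = a i ^ 2 := by
  rw [CellFamily.diagOp, inner_covOp]
  simp_rw [S.inner_combine_cellVec]
  have := gram_diagMat a i i
  rw [if_pos rfl] at this
  exact this

theorem CellFamily.sq_le_norm_diagOp (a : ι → ℝ) (i : ι) : a i ^ 2 ≤ ‖S.diagOp a‖ := by
  have := sq_le_norm_covOp (fun k => S.combine (diagMat a k))
    (S.orthonormal_cellVec.norm_eq_one i) i
  rw [S.inner_combine_cellVec] at this
  rw [CellFamily.diagOp]
  simpa [diagMat] using this

theorem CellFamily.norm_diagOp_le {a : ι → ℝ} {K : ℝ} (hK : 0 ≤ K) (ha : ∀ i, |a i| ≤ K) :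
    ‖S.diagOp a‖ ≤ K ^ 2 := by
  refine norm_covOp_le _ hK fun c => ?_
  have : ∑ i, c i • S.combine (diagMat a i) = S.combine fun i => c i * a i := by
    simp_rw [S.combine_diagMat, smul_smul, CellFamily.combine]
  rw [this, S.norm_combine]
  refine Real.sqrt_le_iff.2 ⟨by positivity, ?_⟩
  rw [mul_pow, Real.sq_sqrt (Finset.sum_nonneg fun i _ => sq_nonneg _), Finset.mul_sum]
  refine Finset.sum_le_sum fun i _ => ?_
  rw [mul_pow, mul_comm]
  exact mul_le_mul_of_nonneg_right
    (sq_le_sq' (abs_le.1 (ha i)).1 (abs_le.1 (ha i)).2) (sq_nonneg _)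

theorem CellFamily.synth_diagMat (a : ι → ℝ) (z : ι → ℝ) :
    synth (fun k => S.combine (diagMat a k)) z = synth S.cellVec fun k => z k * a k := by
  simp_rw [synth_apply, S.combine_diagMat, smul_smul]

theorem CellFamily.diagOp_mem_bandedClass [Nonempty ι] {a : ι → ℝ} {c₁ c₂ r : ℝ} {ν : ℕ+ → ℝ}
    (hc₂ : 0 < c₂) (hνpos : ∀ m, 0 < ν m) (hν : Antitone ν)
    (ha1 : ∀ i, 1 ≤ a i ^ 2) (ha2 : ∀ i, a i ^ 2 ≤ 2)
    (htr : ∑ k, a k ^ 2 ≤ r * ‖S.diagOp a‖)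
    (hc₁ : 0 ≤ c₁) (hcard : v⁻¹ * 2 ≤ c₁ * Fintype.card ι)
    (hcell : ∀ i, ∀ x ∈ S.cell i, ∀ y ∈ S.cell i, euclDist x y ≤ r ^ (-(1 / d : ℝ))) :
    S.diagOp a ∈ bandedClass d c₁ c₂ r ν := by
  refine S.covOp_mem_bandedClass (diagMat a) hc₂ hνpos hν
    ((ha1 _).trans (S.sq_le_norm_diagOp a (Classical.arbitrary ι))) ?_
    (fun i => by rw [gram_diagMat, if_pos rfl]; exact ha1 i)
    (fun i => by rw [gram_diagMat, if_pos rfl]; exact ha2 i) hc₁ hcard hcell 1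
    (fun i j hij h => absurd (by rw [gram_diagMat, if_neg hij]) h) fun i => ?_
  · refine le_trans (le_of_eq (Finset.sum_congr rfl fun k _ => ?_)) htr
    simp [diagMat]
  · rw [Finset.sum_eq_zero fun j hj => by
      rw [gram_diagMat, if_neg (Finset.ne_of_mem_erase hj).symm, abs_zero]]
    have := hνpos 1
    positivity

/-- Testing white noise against the mixture of the alternatives where one coordinate has variance
`1 + δ`: no estimator is closer than a constant times `δ` to all these covariances. -/
theorem CellFamily.le_risk_of_scale [Nonempty ι] {δ : ℝ} (h0 : 0 ≤ δ) (h1 : δ ^ 2 ≤ 1 / 2)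
    (h2 : Real.exp (N * δ ^ 2) ≤ 3 * Fintype.card ι)
    {T : (Fin N → L2 d) → (L2 d →L[ℝ] L2 d)} (hT : IsEstimator T) {M : ℝ≥0∞}
    (hM0 : relRisk T (S.diagOp fun _ => 1)
      (gaussLaw fun k => S.combine (diagMat (fun _ => 1) k)) ≤ M)
    (hM : ∀ j, relRisk T (S.diagOp (Function.update (fun _ => 1) j √(1 + δ)))
      (gaussLaw fun k => S.combine (diagMat (Function.update (fun _ => 1) j √(1 + δ)) k)) ≤ M) :
    ENNReal.ofReal (δ / 64) ≤ M := by
  have hv : 0 < 1 + δ := by linarith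
  have hδ1 : δ ≤ 1 := by nlinarith
  have hnorm := S.orthonormal_cellVec.norm_eq_one
  set f : (Fin N → L2 d) → ℝ≥0∞ := fun U =>
    ⨆ k, ENNReal.ofReal |⟪T U (S.cellVec k), S.cellVec k⟫ - 1| with hf
  have hfm : Measurable f := by
    refine Measurable.iSup fun k => ?_
    exact (((hT (S.cellVec k) (S.cellVec k)).sub_const 1).norm).ennreal_ofReal
  have hcoord : Measurable fun (z : Fin N → ι → ℝ) n => synth S.cellVec (z n) :=
    measurable_pi_lambda _ fun n =>
      (synth S.cellVec).continuous.measurable.comp (measurable_pi_apply n)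
  set φ : (Fin N → ι → ℝ) → ℝ≥0∞ := fun z => f fun n => synth S.cellVec (z n) with hφ
  have hφm : Measurable φ := hfm.comp hcoord
  have two : ENNReal.ofReal 2 = 2 := by norm_num
  have hdiv : ∀ {A : ℝ≥0∞}, A / ENNReal.ofReal 2 ≤ M → A ≤ M * 2 := fun {A} h => by
    rw [two] at h
    exact (ENNReal.div_le_iff (by norm_num) (by norm_num)).1 h
  have hnull : ∫⁻ z, φ z ∂noiseSample N ι ≤ M * 2 := by
    refine hdiv (le_trans (le_of_eq ?_) ((le_relRisk (fun k => S.combine (diagMat (fun _ => 1) k)) T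
      (K := 2) ?_ f hfm fun U => ?_).trans hM0))
    · simp_rw [S.synth_diagMat, mul_one, hφ]
    · refine (S.norm_diagOp_le (K := 1) zero_le_one (by simp)).trans (by norm_num)
    · refine iSup_le fun k => ?_
      have := ofReal_abs_inner_sub_le (T U) (S.diagOp fun _ => 1) (hnorm k) (hnorm k)
      rwa [S.inner_diagOp, one_pow] at this
  have halt : ∀ j, ∫⁻ z, (ENNReal.ofReal δ - φ z) * scaleLR (1 + δ) j z ∂noiseSample N ι ≤
      M * 2 := by
    intro j
    rw [← lintegral_map_scale hv j _ (by fun_prop)]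
    refine hdiv (le_trans (le_of_eq ?_) ((le_relRisk (fun k => S.combine
      (diagMat (Function.update (fun _ => 1) j √(1 + δ)) k)) T (K := 2) ?_
      (fun U => ENNReal.ofReal δ - f U) (by fun_prop) fun U => ?_).trans (hM j)))
    · simp_rw [S.synth_diagMat]
      congr 1
      refine lintegral_congr fun z => ?_
      simp only [hφ]
      congr 2
      ext1 n
      congr 1
      ext1 k
      by_cases hk : k = j
      · subst hk; simp [mul_comm]
      · simp [hk]
    · refine (S.norm_diagOp_le (K := √(1 + δ)) (Real.sqrt_nonneg _) fun i => ?_).trans ?_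
      · by_cases hi : i = j
        · subst hi; simp [abs_of_nonneg]
        · simp [hi, Real.one_le_sqrt, h0]
      · rw [Real.sq_sqrt hv.le]; linarith
    · rw [tsub_le_iff_left]
      have h3 := ofReal_abs_inner_sub_le (T U)
        (S.diagOp (Function.update (fun _ => 1) j √(1 + δ))) (hnorm j) (hnorm j)
      rw [S.inner_diagOp, Function.update_self, Real.sq_sqrt hv.le] at h3
      set t := ⟪T U (S.cellVec j), S.cellVec j⟫
      calc ENNReal.ofReal δ ≤ ENNReal.ofReal (|t - 1| + |t - (1 + δ)|) := by
            refine ENNReal.ofReal_le_ofReal ?_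
            have := abs_sub_abs_le_abs_sub (t - 1) (t - (1 + δ))
            have h4 := le_abs_self (t - 1)
            have h5 := neg_abs_le (t - (1 + δ))
            linarith
        _ = ENNReal.ofReal |t - 1| + ENNReal.ofReal |t - (1 + δ)| :=
            ENNReal.ofReal_add (abs_nonneg _) (abs_nonneg _)
        _ ≤ _ := add_le_add (le_iSup (fun k =>
            ENNReal.ofReal |⟪T U (S.cellVec k), S.cellVec k⟫ - 1|) j) h3
  set R : ℝ≥0∞ := (Fintype.card ι : ℝ≥0∞) with hR
  have hR0 : R ≠ 0 := by simp [hR]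
  have hRt : R ≠ ∞ := by simp [hR]
  have hmix : ∫⁻ z, (ENNReal.ofReal δ - φ z) * (∑ j : ι, R⁻¹ * scaleLR (1 + δ) j z)
      ∂noiseSample N ι ≤ M * 2 := by
    simp_rw [Finset.mul_sum, mul_left_comm _ R⁻¹]
    rw [lintegral_finsetSum _ fun j _ => by fun_prop]
    simp_rw [lintegral_const_mul' R⁻¹ _ (ENNReal.inv_ne_top.2 hR0)]
    calc _ ≤ ∑ _j : ι, R⁻¹ * (M * 2) := by gcongr with j; exact halt j
      _ = (R * R⁻¹) * (M * 2) := by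
          rw [Finset.sum_const, Finset.card_univ, nsmul_eq_mul, ← hR, mul_assoc]
      _ = M * 2 := by rw [ENNReal.mul_inv_cancel hR0 hRt, one_mul]
  -- the error `φ` under white noise and the error `δ - φ` under the mixture cannot both be small
  have hpt : ∀ z, ENNReal.ofReal δ * min 1 (∑ j : ι, R⁻¹ * scaleLR (1 + δ) j z) ≤
      φ z + (ENNReal.ofReal δ - φ z) * (∑ j : ι, R⁻¹ * scaleLR (1 + δ) j z) := by
    intro z
    set L := ∑ j : ι, R⁻¹ * scaleLR (1 + δ) j z
    calc ENNReal.ofReal δ * min 1 L ≤ (φ z + (ENNReal.ofReal δ - φ z)) * min 1 L := by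
          gcongr; exact le_add_tsub
      _ = φ z * min 1 L + (ENNReal.ofReal δ - φ z) * min 1 L := add_mul _ _ _
      _ ≤ φ z * 1 + (ENNReal.ofReal δ - φ z) * L := by
          gcongr
          · exact min_le_left _ _
          · exact min_le_right _ _
      _ = _ := by rw [mul_one]
  have hfinal : ENNReal.ofReal (δ / 16) ≤ M * 2 + M * 2 := by
    calc ENNReal.ofReal (δ / 16) = ENNReal.ofReal δ * ENNReal.ofReal (1 / 16) := by
          rw [← ENNReal.ofReal_mul h0]; congr 1; ring
      _ ≤ ENNReal.ofReal δ * ∫⁻ z, min 1 (∑ j : ι, R⁻¹ * scaleLR (1 + δ) j z)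
          ∂noiseSample N ι := by gcongr; exact le_lintegral_min_mixture h0 h1 h2
      _ ≤ ∫⁻ z, φ z + (ENNReal.ofReal δ - φ z) * (∑ j : ι, R⁻¹ * scaleLR (1 + δ) j z)
          ∂noiseSample N ι := by
          rw [← lintegral_const_mul' _ _ ENNReal.ofReal_ne_top]
          exact lintegral_mono hpt
      _ ≤ M * 2 + M * 2 := by
          rw [lintegral_add_left hφm]
          exact add_le_add hnull hmix
  have : δ / 64 = δ / 16 / 4 := by ring
  rw [this, ENNReal.ofReal_div_of_pos (by norm_num)]
  refine ENNReal.div_le_of_le_mul (hfinal.trans (le_of_eq ?_))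
  rw [← mul_add]
  norm_num

end Diag

/-- The grid used for effective dimension `r`: mesh of order `r^{-1/d}`, fine enough for a cell to
have diameter at most `r^{-1/d}`. -/
theorem exists_grid {d : ℕ} (hd : 1 ≤ d) {r : ℝ} (hr : 1 ≤ r) :
    ∃ n : ℕ, 0 < n ∧ d * r ^ (1 / d : ℝ) ≤ n ∧ r ≤ (n : ℝ) ^ d ∧
      (n : ℝ) ^ d ≤ (2 * d : ℝ) ^ d * r := by
  have hd' : (1 : ℝ) ≤ d := by exact_mod_cast hd
  have hq : 1 ≤ r ^ (1 / d : ℝ) := Real.one_le_rpow hr (by positivity)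
  have hqd : (r ^ (1 / d : ℝ)) ^ d = r := by
    rw [one_div]; exact Real.rpow_inv_natCast_pow (by linarith) (by omega)
  set q := r ^ (1 / d : ℝ) with hqdef
  have h1 := Nat.le_ceil (d * q)
  have h2 := (Nat.ceil_lt_add_one (show 0 ≤ d * q by positivity)).le
  have h3 : 1 ≤ d * q := by nlinarith
  refine ⟨⌈d * q⌉₊, Nat.ceil_pos.2 (by linarith), h1, ?_, ?_⟩
  · calc r = q ^ d := hqd.symm
      _ ≤ _ := by gcongr; nlinarith
  · calc (⌈d * q⌉₊ : ℝ) ^ d ≤ (2 * d * q) ^ d := by gcongr; linarith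
      _ = _ := by rw [mul_pow, hqd]

/-- The lower bound of order `√((1 + log r) / N)`, from `⌊r⌋` cells. -/
theorem minimaxRisk_ge_log {d : ℕ} (hd : 1 ≤ d) {c₁ c₂ : ℝ} (hc₁ : 8 * (2 * d : ℝ) ^ d ≤ c₁)
    (hc₂ : 0 < c₂) {ν : ℕ+ → ℝ} (hνpos : ∀ m, 0 < ν m) (hν : Antitone ν)
    {N : ℕ} {r : ℝ} (hr : 1 < r) (hN : Real.log r < N) :
    ENNReal.ofReal (√((1 + Real.log r) / N) / 256) ≤ minimaxRisk d N (bandedClass d c₁ c₂ r ν) := by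
  obtain ⟨n, hn, hn1, hn2, hn3⟩ := exists_grid hd hr.le
  have hlog : 0 < Real.log r := Real.log_pos hr
  have hN0 : 0 < N := by exact_mod_cast hlog.trans hN
  have hN1 : (1 : ℝ) ≤ N := by exact_mod_cast hN0
  set R := ⌊r⌋₊ with hR
  have hR1 : 1 ≤ R := Nat.le_floor (by simpa using hr.le)
  have hR1' : (1 : ℝ) ≤ R := by exact_mod_cast hR1
  have hRr : (R : ℝ) ≤ r := Nat.floor_le (by linarith)
  have hrR : r < R + 1 := Nat.lt_floor_add_one r
  have hne : Nonempty (Fin R) := ⟨⟨0, hR1⟩⟩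
  obtain ⟨κ⟩ : Nonempty (Fin R ↪ (Fin d → Fin n)) := by
    refine Function.Embedding.nonempty_of_card_le ?_
    simp only [Fintype.card_fin, Fintype.card_pi, Finset.prod_const, Finset.card_univ]
    exact_mod_cast hRr.trans hn2
  let S := gridFamily d n hn κ κ.injective
  have hlogR : Real.log R ≤ Real.log r := Real.log_le_log (by linarith) hRr
  have hlogR0 : 0 ≤ Real.log R := Real.log_nonneg hR1'
  have hlogr : Real.log r ≤ 1 + Real.log R := by
    rw [← Real.log_exp 1, ← Real.log_mul (Real.exp_pos 1).ne' (by linarith)]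
    refine Real.log_le_log (by linarith) ?_
    nlinarith [Real.add_one_le_exp (1 : ℝ)]
  -- then `exp (N δ²) = exp ((1 + log R) / 8) ≤ 3 R`
  set δ := √((1 + Real.log R) / (8 * N)) with hδ
  have hδ0 : 0 ≤ δ := Real.sqrt_nonneg _
  have hδsq : δ ^ 2 = (1 + Real.log R) / (8 * N) := Real.sq_sqrt (by positivity)
  have hδ1 : δ ^ 2 ≤ 1 / 2 := by
    rw [hδsq, div_le_div_iff₀ (by positivity) (by norm_num)]; linarith
  have hexp : Real.exp (N * δ ^ 2) ≤ 3 * Fintype.card (Fin R) := by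
    have : N * δ ^ 2 = (1 + Real.log R) / 8 := by rw [hδsq]; field_simp
    rw [this, Fintype.card_fin]
    calc Real.exp ((1 + Real.log R) / 8) ≤ Real.exp (1 + Real.log R) :=
          Real.exp_le_exp.2 (by linarith)
      _ = Real.exp 1 * R := by rw [Real.exp_add, Real.exp_log (by linarith)]
      _ ≤ 3 * R := by gcongr; exact Real.exp_one_lt_three.le
  have hδle : δ ≤ 1 := by nlinarith
  have hc₁0 : 0 ≤ c₁ := le_trans (by positivity) hc₁
  have hcard : ((n : ℝ) ^ d)⁻¹⁻¹ * 2 ≤ c₁ * Fintype.card (Fin R) := by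
    rw [inv_inv, Fintype.card_fin]
    calc (n : ℝ) ^ d * 2 ≤ (2 * d : ℝ) ^ d * r * 2 := by gcongr
      _ ≤ (2 * d : ℝ) ^ d * (4 * R) * 2 := by gcongr; linarith
      _ = 8 * (2 * d : ℝ) ^ d * R := by ring
      _ ≤ c₁ * R := by gcongr
  have hcell : ∀ i, ∀ x ∈ S.cell i, ∀ y ∈ S.cell i, euclDist x y ≤ r ^ (-(1 / d : ℝ)) :=
    fun i x hx y hy => euclDist_gridCell_self_le hd (by linarith) hn1 hx hy
  refine le_iInf₂ fun T hT => ?_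
  refine le_trans (ENNReal.ofReal_le_ofReal ?_)
    (S.le_risk_of_scale hδ0 hδ1 hexp hT (relRisk_le_iSup _ ?_ T) fun j => relRisk_le_iSup _ ?_ T)
  · have : √((1 + Real.log r) / N) ≤ 4 * δ := by
      refine Real.sqrt_le_iff.2 ⟨by positivity, ?_⟩
      rw [mul_pow, hδsq, div_le_iff₀ (by positivity)]
      field_simp
      linarith
    linarith
  · refine S.diagOp_mem_bandedClass hc₂ hνpos hν (by simp) (by norm_num) ?_ hc₁0 hcard hcell
    have h1 := S.sq_le_norm_diagOp (fun _ => 1) ⟨0, hR1⟩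
    simp only [one_pow, Finset.sum_const, Finset.card_univ, Fintype.card_fin, nsmul_eq_mul,
      mul_one] at h1 ⊢
    nlinarith
  · have hsq : ∀ i, (Function.update (fun _ => (1 : ℝ)) j √(1 + δ)) i ^ 2 =
        1 + if i = j then δ else 0 := by
      intro i
      by_cases hi : i = j
      · subst hi; simp [Real.sq_sqrt (show 0 ≤ 1 + δ by linarith)]
      · simp [hi]
    refine S.diagOp_mem_bandedClass hc₂ hνpos hν (fun i => ?_) (fun i => ?_) ?_ hc₁0 hcard hcell
    · rw [hsq]; split_ifs <;> linarith
    · rw [hsq]; split_ifs <;> linarith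
    · have h1 := S.sq_le_norm_diagOp (Function.update (fun _ => 1) j √(1 + δ)) j
      rw [hsq, if_pos rfl] at h1
      simp_rw [hsq]
      rw [Finset.sum_add_distrib]
      simp only [Finset.sum_const, Finset.card_univ, Fintype.card_fin, nsmul_eq_mul, mul_one,
        Finset.sum_ite_eq', Finset.mem_univ, if_true]
      calc (R : ℝ) + δ ≤ R * (1 + δ) := by nlinarith
        _ ≤ r * (1 + δ) := by gcongr
        _ ≤ _ := by gcongr

/-! ### Testing two opposite shears of white noise -/

section TwoPoint

variable {N : ℕ} {ι : Type*} [Fintype ι] [DecidableEq ι]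

/-- The law of `N` samples of white noise sheared along coordinate `i` by an amount `s` that does
not depend on that coordinate. -/
theorem lintegral_map_shear (i : ι) {s : (ι → ℝ) → ℝ} (hs : Measurable s)
    (hsi : ∀ x y, s (Function.update x i y) = s x) (G : (Fin N → ι → ℝ) → ℝ≥0∞)
    (hG : Measurable G) :
    ∫⁻ z, G (fun n => Function.update (z n) i (z n i + s (z n))) ∂noiseSample N ι =
      ∫⁻ z, G z * ENNReal.ofReal (Real.exp (∑ n, s (z n) * z n i) *
        Real.exp (-∑ n, s (z n) ^ 2 / 2)) ∂noiseSample N ι := by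
  rw [lintegral_noiseSample_map (fun x => Function.update x i (x i + s x))
    (by
      rw [measurable_pi_iff]
      intro j
      by_cases hj : j = i
      · subst hj; simp only [Function.update_self]; fun_prop
      · simp only [Function.update_of_ne hj]; fun_prop)
    _ (by fun_prop) (whiteNoise_map_shear i s hs hsi) G hG]
  refine lintegral_congr fun z => ?_
  rw [← ENNReal.ofReal_prod_of_nonneg fun n _ => (Real.exp_pos _).le, ← Real.exp_sum,
    ← Real.exp_add, Finset.sum_sub_distrib, sub_eq_add_neg]

/-- Pointwise form of the testing bound: `e^{-|y|} + (e^y + e^{-y}) / 4 ≥ 1`. -/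
theorem two_point_pointwise {a x y h : ℝ} (ha : 0 ≤ a) (hh : 0 ≤ h) :
    2 * a * h ≤ |x - a| * (Real.exp y * h) + |x + a| * (Real.exp (-y) * h) +
      a / 2 * (Real.exp y * h + Real.exp (-y) * h) := by
  have hy := Real.exp_pos y
  have hy' := Real.exp_pos (-y)
  have hprod : Real.exp y * Real.exp (-y) = 1 := by rw [← Real.exp_add]; simp
  have h2 : 2 * a ≤ |x - a| + |x + a| := by
    have := abs_sub (x + a) (x - a)
    have h3 := le_abs_self (x + a - (x - a))
    linarith
  have key : ∀ u v : ℝ, 0 < u → u * v = 1 → u ≤ v →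
      1 ≤ u + (u + v) / 4 := fun u v hu huv _ => by
    have hv : 0 < v := by by_contra hv; nlinarith
    nlinarith [sq_nonneg (2 * u - v), sq_nonneg (u + v / 4 - 1)]
  have main : 2 * a ≤ |x - a| * Real.exp y + |x + a| * Real.exp (-y) +
      a / 2 * (Real.exp y + Real.exp (-y)) := by
    have hx1 := abs_nonneg (x - a)
    have hx2 := abs_nonneg (x + a)
    rcases le_total (Real.exp y) (Real.exp (-y)) with h' | h'
    · have := key _ _ hy hprod h'
      nlinarith [mul_le_mul_of_nonneg_left h' hx2]
    · have := key _ _ hy' (by rw [mul_comm]; exact hprod) h'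
      nlinarith [mul_le_mul_of_nonneg_left h' hx1]
  nlinarith [mul_le_mul_of_nonneg_right main hh]

/-- Le Cam's bound for two opposite shears of white noise along coordinate `i`, by amounts `± s`
that do not depend on that coordinate: no statistic `g` estimates both `a` and `-a` well. -/
theorem two_point_shear (i : ι) {s : (ι → ℝ) → ℝ} (hs : Measurable s)
    (hsi : ∀ x y, s (Function.update x i y) = s x)
    (hs2 : N * ∫⁻ x, ENNReal.ofReal (s x ^ 2) ∂whiteNoise ι ≤ ENNReal.ofReal (1 / 2))
    {g : (Fin N → ι → ℝ) → ℝ} (hg : Measurable g) {a : ℝ} (ha : 0 ≤ a) :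
    ENNReal.ofReal (a / 2) ≤
      ∫⁻ z, ENNReal.ofReal |g (fun n => Function.update (z n) i (z n i + s (z n))) - a|
        ∂noiseSample N ι +
      ∫⁻ z, ENNReal.ofReal |g (fun n => Function.update (z n) i (z n i - s (z n))) + a|
        ∂noiseSample N ι := by
  have hs' : Measurable fun x => -s x := hs.neg
  have hsi' : ∀ x y, -s (Function.update x i y) = -s x := fun x y => by rw [hsi]
  set y : (Fin N → ι → ℝ) → ℝ := fun z => ∑ n, s (z n) * z n i with hy
  set h : (Fin N → ι → ℝ) → ℝ := fun z => Real.exp (-∑ n, s (z n) ^ 2 / 2) with hh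
  have hym : Measurable y := by fun_prop
  have hhm : Measurable h := by fun_prop
  set ratioP : (Fin N → ι → ℝ) → ℝ≥0∞ := fun z => ENNReal.ofReal (Real.exp (y z) * h z) with hP
  set ratioM : (Fin N → ι → ℝ) → ℝ≥0∞ := fun z => ENNReal.ofReal (Real.exp (-y z) * h z) with hM
  have hplus : ∀ G : (Fin N → ι → ℝ) → ℝ≥0∞, Measurable G →
      ∫⁻ z, G (fun n => Function.update (z n) i (z n i + s (z n))) ∂noiseSample N ι =
        ∫⁻ z, G z * ratioP z ∂noiseSample N ι := lintegral_map_shear i hs hsi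
  have hminus : ∀ G : (Fin N → ι → ℝ) → ℝ≥0∞, Measurable G →
      ∫⁻ z, G (fun n => Function.update (z n) i (z n i - s (z n))) ∂noiseSample N ι =
        ∫⁻ z, G z * ratioM z ∂noiseSample N ι := fun G hG => by
    have := lintegral_map_shear (N := N) i hs' hsi' G hG
    simpa only [neg_sq, neg_mul, Finset.sum_neg_distrib, ← sub_eq_add_neg] using this
  have hP1 : ∫⁻ z, ratioP z ∂noiseSample N ι = 1 := by
    simpa using (hplus (fun _ => 1) measurable_const).symm
  have hM1 : ∫⁻ z, ratioM z ∂noiseSample N ι = 1 := by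
    simpa using (hminus (fun _ => 1) measurable_const).symm
  -- the common factor `h` of both likelihood ratios has integral at least `3 / 4`
  have hone : (1 : ℝ≥0∞) ≤ ∫⁻ z, ENNReal.ofReal (h z) ∂noiseSample N ι +
      ENNReal.ofReal (1 / 4) := by
    have hpt : ∀ z, (1 : ℝ≥0∞) ≤ ENNReal.ofReal (h z) +
        ∑ n, ENNReal.ofReal (1 / 2) * ENNReal.ofReal (s (z n) ^ 2) := fun z => by
      have e : ∑ n, ENNReal.ofReal (1 / 2) * ENNReal.ofReal (s (z n) ^ 2) =
          ENNReal.ofReal (∑ n, s (z n) ^ 2 / 2) := by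
        rw [ENNReal.ofReal_sum_of_nonneg fun n _ => by positivity]
        refine Finset.sum_congr rfl fun n _ => ?_
        rw [← ENNReal.ofReal_mul (by norm_num)]
        congr 1; ring
      have e2 : (0 : ℝ) ≤ ∑ n, s (z n) ^ 2 / 2 := Finset.sum_nonneg fun n _ => by positivity
      rw [e, ← ENNReal.ofReal_add (Real.exp_pos _).le e2, ← ENNReal.ofReal_one]
      refine ENNReal.ofReal_le_ofReal ?_
      have := Real.add_one_le_exp (-∑ n, s (z n) ^ 2 / 2)
      linarith
    have hev : ∀ n : Fin N, ∫⁻ z, ENNReal.ofReal (s (z n) ^ 2) ∂noiseSample N ι =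
        ∫⁻ x, ENNReal.ofReal (s x ^ 2) ∂whiteNoise ι := fun n =>
      (measurePreserving_eval (fun _ : Fin N => whiteNoise ι) n).lintegral_comp
        (f := fun x => ENNReal.ofReal (s x ^ 2)) (by fun_prop)
    calc (1 : ℝ≥0∞) = ∫⁻ _z, 1 ∂noiseSample N ι := by simp
      _ ≤ ∫⁻ z, ENNReal.ofReal (h z) + ∑ n, ENNReal.ofReal (1 / 2) * ENNReal.ofReal (s (z n) ^ 2)
          ∂noiseSample N ι := lintegral_mono hpt
      _ = ∫⁻ z, ENNReal.ofReal (h z) ∂noiseSample N ι + ENNReal.ofReal (1 / 2) *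
          (N * ∫⁻ x, ENNReal.ofReal (s x ^ 2) ∂whiteNoise ι) := by
          rw [lintegral_add_left (by fun_prop), lintegral_finsetSum _ fun n _ => by fun_prop]
          simp_rw [lintegral_const_mul' _ _ ENNReal.ofReal_ne_top, hev]
          simp only [Finset.sum_const, Finset.card_univ, Fintype.card_fin, nsmul_eq_mul]
          ring
      _ ≤ ∫⁻ z, ENNReal.ofReal (h z) ∂noiseSample N ι +
          ENNReal.ofReal (1 / 2) * ENNReal.ofReal (1 / 2) := by gcongr
      _ = _ := by rw [← ENNReal.ofReal_mul (by norm_num)]; norm_num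
  rw [hplus (fun z => ENNReal.ofReal |g z - a|) (by fun_prop),
    hminus (fun z => ENNReal.ofReal |g z + a|) (by fun_prop)]
  have hpt : ∀ z, ENNReal.ofReal (2 * a) * ENNReal.ofReal (h z) ≤
      ENNReal.ofReal |g z - a| * ratioP z + ENNReal.ofReal |g z + a| * ratioM z +
        ENNReal.ofReal (a / 2) * (ratioP z + ratioM z) := fun z => by
    have h0 : 0 ≤ h z := (Real.exp_pos _).le
    simp only [hP, hM]
    rw [← ENNReal.ofReal_mul (by positivity), ← ENNReal.ofReal_mul (by positivity),
      ← ENNReal.ofReal_mul (by positivity), ← ENNReal.ofReal_add (by positivity) (by positivity),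
      ← ENNReal.ofReal_add (by positivity) (by positivity), ← ENNReal.ofReal_mul (by positivity),
      ← ENNReal.ofReal_add (by positivity) (by positivity)]
    exact ENNReal.ofReal_le_ofReal (two_point_pointwise ha h0)
  set X := ∫⁻ z, ENNReal.ofReal |g z - a| * ratioP z ∂noiseSample N ι
  set Y := ∫⁻ z, ENNReal.ofReal |g z + a| * ratioM z ∂noiseSample N ι
  have hsum : ENNReal.ofReal (2 * a) * ∫⁻ z, ENNReal.ofReal (h z) ∂noiseSample N ι ≤
      X + Y + ENNReal.ofReal a := by
    calc _ = ∫⁻ z, ENNReal.ofReal (2 * a) * ENNReal.ofReal (h z) ∂noiseSample N ι :=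
          (lintegral_const_mul' _ _ ENNReal.ofReal_ne_top).symm
      _ ≤ _ := lintegral_mono hpt
      _ = X + Y + ENNReal.ofReal (a / 2) * (1 + 1) := by
          rw [lintegral_add_left (by fun_prop), lintegral_add_left (by fun_prop),
            lintegral_const_mul' _ _ ENNReal.ofReal_ne_top, lintegral_add_left (by fun_prop),
            hP1, hM1]
      _ = _ := by
          rw [mul_add, mul_one, ← ENNReal.ofReal_add (by positivity) (by positivity), add_halves]
  have hle : ENNReal.ofReal (2 * a) ≤ X + Y + ENNReal.ofReal (3 * a / 2) := by
    calc ENNReal.ofReal (2 * a) = ENNReal.ofReal (2 * a) * 1 := (mul_one _).symm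
      _ ≤ ENNReal.ofReal (2 * a) * (∫⁻ z, ENNReal.ofReal (h z) ∂noiseSample N ι +
          ENNReal.ofReal (1 / 4)) := by gcongr
      _ ≤ X + Y + ENNReal.ofReal a + ENNReal.ofReal (a / 2) := by
          rw [mul_add, ← ENNReal.ofReal_mul (by positivity)]
          refine add_le_add hsum (ENNReal.ofReal_le_ofReal (by linarith))
      _ = _ := by
          rw [add_assoc, ← ENNReal.ofReal_add ha (by positivity)]; congr 2; ring
  have : ENNReal.ofReal (a / 2) + ENNReal.ofReal (3 * a / 2) ≤
      X + Y + ENNReal.ofReal (3 * a / 2) := by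
    rw [← ENNReal.ofReal_add (by positivity) (by positivity)]
    refine le_trans (le_of_eq ?_) hle
    congr 1; ring
  exact (ENNReal.add_le_add_iff_right ENNReal.ofReal_ne_top).1 this

end TwoPoint

/-! ### Sign-indexed regressions inside a block -/

/-- The matrix `1 + t h wᵀ`. -/
def spikeMat {ι : Type*} [DecidableEq ι] (t : ℝ) (h w : ι → ℝ) (k i : ι) : ℝ :=
  (if k = i then 1 else 0) + t * h k * w i

theorem gram_spikeMat {ι : Type*} [Fintype ι] [DecidableEq ι] (t : ℝ) (h w : ι → ℝ) (i j : ι) :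
    gram (spikeMat t h w) i j = (if i = j then 1 else 0) + t * h i * w j + t * h j * w i +
      t ^ 2 * (∑ k, h k ^ 2) * (w i * w j) := by
  have : ∀ k, spikeMat t h w k i * spikeMat t h w k j =
      (if k = i then (if k = j then 1 else 0) else 0) + (if k = i then t * h k * w j else 0) +
        (if k = j then t * h k * w i else 0) + t ^ 2 * (w i * w j) * h k ^ 2 := fun k => by
    unfold spikeMat
    split_ifs <;> ring
  simp_rw [gram, this, Finset.sum_add_distrib, ← Finset.mul_sum]
  simp only [Finset.sum_ite_eq', Finset.mem_univ, if_true]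
  ring

section Sign

variable {ι : Type*} [DecidableEq ι]

/-- The indicator function of a finite set of indices. -/
def indic (A : Finset ι) (i : ι) : ℝ := if i ∈ A then 1 else 0

/-- The vector `θ` restricted to the finite set `B` of indices. -/
def signVec (B : Finset ι) (θ : ι → ℝ) (i : ι) : ℝ := if i ∈ B then θ i else 0

variable [Fintype ι]

theorem sum_indic_mul (A : Finset ι) (z : ι → ℝ) : ∑ k, indic A k * z k = ∑ k ∈ A, z k := by
  simp [indic, Finset.sum_ite_mem]

theorem sum_indic (A : Finset ι) : ∑ k, indic A k = A.card := by
  simp [indic]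

theorem sum_indic_sq (A : Finset ι) : ∑ k, indic A k ^ 2 = A.card := by
  simp [indic]

theorem sum_abs_signVec {B : Finset ι} {θ : ι → ℝ} (hθ : ∀ i, |θ i| = 1) :
    ∑ i, |signVec B θ i| = B.card := by
  have : ∀ i, |signVec B θ i| = if i ∈ B then 1 else 0 := fun i => by
    unfold signVec; split_ifs <;> simp [hθ]
  simp [this]

theorem sum_signVec_sq {B : Finset ι} {θ : ι → ℝ} (hθ : ∀ i, |θ i| = 1) :
    ∑ i, signVec B θ i ^ 2 = B.card := by
  have : ∀ i, signVec B θ i ^ 2 = if i ∈ B then 1 else 0 := fun i => by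
    unfold signVec
    split_ifs
    · rw [← sq_abs, hθ, one_pow]
    · simp
  simp [this]

end Sign

section Spike

variable {d N : ℕ} {ι : Type*} [Fintype ι] [DecidableEq ι] {v : ℝ} (S : CellFamily d ι v)

theorem CellFamily.combine_spikeMat (t : ℝ) (h w : ι → ℝ) (k : ι) :
    S.combine (spikeMat t h w k) = S.cellVec k + (t * h k) • S.combine w := by
  simp [CellFamily.combine, spikeMat, add_smul, Finset.sum_add_distrib, Finset.smul_sum,
    smul_smul]

theorem CellFamily.sum_smul_spikeMat (t : ℝ) (h w c : ι → ℝ) :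
    ∑ k, c k • S.combine (spikeMat t h w k) =
      S.combine c + (t * ∑ k, h k * c k) • S.combine w := by
  simp_rw [S.combine_spikeMat, smul_add, Finset.sum_add_distrib, smul_smul, ← Finset.sum_smul]
  rw [Finset.mul_sum]
  congr 2
  exact Finset.sum_congr rfl fun k _ => by ring

/-- The covariance operator of `∑ₖ zₖ eₖ + t (∑_{k ∈ A} zₖ) ∑_{i ∈ B} θᵢ eᵢ`. -/
noncomputable def CellFamily.spikeOp (t : ℝ) (A B : Finset ι) (θ : ι → ℝ) : L2 d →L[ℝ] L2 d :=
  covOp fun k => S.combine (spikeMat t (indic A) (signVec B θ) k)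

/-- Synthesis is the identity plus a rank-one map of norm `t p`, hence the operator is bounded by
`(1 + t p)² ≤ 4`. -/
theorem CellFamily.norm_spikeOp_le {t : ℝ} {A B : Finset ι} {θ : ι → ℝ} {p : ℕ}
    (hA : A.card = p) (hB : B.card = p) (hθ : ∀ i, |θ i| = 1) (ht : 0 ≤ t) (htp : t * p ≤ 1) :
    ‖S.spikeOp t A B θ‖ ≤ 4 := by
  refine (norm_covOp_le _ zero_le_two fun c => ?_).trans (by norm_num)
  rw [S.sum_smul_spikeMat]
  refine (norm_add_le _ _).trans ?_
  rw [norm_smul, S.norm_combine, S.norm_combine, sum_signVec_sq hθ, hB, two_mul]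
  set q := √(∑ i, c i ^ 2)
  have h1 : |∑ k, indic A k * c k| ≤ √p * q := by
    rw [← Real.sqrt_mul (by positivity)]
    refine Real.abs_le_sqrt ?_
    have := Finset.sum_mul_sq_le_sq_mul_sq Finset.univ (indic A) c
    rwa [sum_indic_sq, hA] at this
  have h2 : ‖t * ∑ k, indic A k * c k‖ * √p ≤ q := by
    rw [norm_mul, Real.norm_of_nonneg ht, Real.norm_eq_abs]
    calc t * |∑ k, indic A k * c k| * √p ≤ t * (√p * q) * √p := by gcongr
      _ = t * (√p * √p) * q := by ring
      _ = t * p * q := by rw [Real.mul_self_sqrt (by positivity)]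
      _ ≤ 1 * q := by gcongr
      _ = q := one_mul q
  linarith

/-- The test direction: the normalised sum of the vectors indexed by `A`. -/
noncomputable def CellFamily.testVec (A : Finset ι) : L2 d :=
  (√A.card)⁻¹ • S.combine (indic A)

theorem CellFamily.norm_testVec {A : Finset ι} (hA : 0 < A.card) :
    ‖S.testVec A‖ = 1 := by
  have : (0 : ℝ) < A.card := by exact_mod_cast hA
  rw [CellFamily.testVec, norm_smul, S.norm_combine, sum_indic_sq,
    Real.norm_of_nonneg (by positivity)]
  exact inv_mul_cancel₀ (Real.sqrt_pos.2 this).ne'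

/-- The signs `θᵢ` are linear functionals of the covariance operator. -/
theorem CellFamily.inner_spikeOp_testVec {t : ℝ} {A B : Finset ι} (hAB : Disjoint A B)
    (hA : 0 < A.card) (θ : ι → ℝ) {i : ι} (hi : i ∈ B) :
    ⟪S.spikeOp t A B θ (S.testVec A), S.cellVec i⟫ = t * √A.card * θ i := by
  have hApos : (0 : ℝ) < A.card := by exact_mod_cast hA
  have hiA : i ∉ A := fun h => Finset.disjoint_left.1 hAB h hi
  have hort : ∑ j, signVec B θ j * indic A j = 0 := Finset.sum_eq_zero fun j _ => by
    unfold signVec indic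
    by_cases hj : j ∈ A
    · simp [hj, Finset.disjoint_left.1 hAB hj]
    · simp [hj]
  have h1 : ∀ k, ⟪S.combine (spikeMat t (indic A) (signVec B θ) k), S.testVec A⟫ =
      (√A.card)⁻¹ * indic A k := fun k => by
    rw [CellFamily.testVec, real_inner_smul_right, S.inner_combine]
    congr 1
    simp only [spikeMat, add_mul, Finset.sum_add_distrib, mul_assoc, ← Finset.mul_sum, hort]
    simp
  rw [CellFamily.spikeOp, inner_covOp]
  simp_rw [h1, S.inner_combine_cellVec]
  have h2 : ∀ k, (√A.card)⁻¹ * indic A k * spikeMat t (indic A) (signVec B θ) k i =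
      (√A.card)⁻¹ * (indic A k * if k = i then 1 else 0) +
        (√A.card)⁻¹ * t * θ i * indic A k ^ 2 := fun k => by
    simp only [spikeMat, signVec, hi, if_true]; ring
  simp_rw [h2, Finset.sum_add_distrib, ← Finset.mul_sum, sum_indic_sq]
  have h3 : ∑ k, indic A k * (if k = i then (1 : ℝ) else 0) = 0 := by
    simp [indic, hiA]
  rw [h3, mul_zero, zero_add]
  have h4 : (√A.card)⁻¹ * (A.card : ℝ) = √A.card := by
    rw [inv_mul_eq_iff_eq_mul₀ (Real.sqrt_pos.2 hApos).ne', Real.mul_self_sqrt hApos.le]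
  linear_combination (t * θ i) * h4

/-- Setting the sign `θᵢ` to `τ` instead of `0` amounts to a shear of the noise along
coordinate `i`. -/
theorem CellFamily.synth_spike_update (t : ℝ) {A B : Finset ι} (hAB : Disjoint A B)
    (θ : ι → ℝ) {i : ι}
    (hi : i ∈ B) (z : ι → ℝ) (τ : ℝ) :
    synth (fun k => S.combine (spikeMat t (indic A) (signVec B (Function.update θ i τ)) k)) z =
      synth (fun k => S.combine (spikeMat t (indic A) (signVec B (Function.update θ i 0)) k))
        (Function.update z i (z i + τ * (t * ∑ k ∈ A, z k))) := by
  have hiA : i ∉ A := fun h => Finset.disjoint_left.1 hAB h hi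
  have hs : ∀ y, ∑ k ∈ A, Function.update z i y k = ∑ k ∈ A, z k := fun y =>
    Finset.sum_congr rfl fun k hk => Function.update_of_ne (ne_of_mem_of_not_mem hk hiA) _ _
  simp_rw [synth_apply, S.sum_smul_spikeMat, sum_indic_mul, hs]
  have hw : S.combine (signVec B (Function.update θ i τ)) =
      S.combine (signVec B (Function.update θ i 0)) + τ • S.cellVec i := by
    unfold CellFamily.combine
    rw [← Finset.add_sum_erase _ _ (Finset.mem_univ i),
      ← Finset.add_sum_erase _ (fun k => signVec B (Function.update θ i 0) k • S.cellVec k)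
        (Finset.mem_univ i), add_right_comm]
    congr 1
    · simp [signVec, hi]
    · refine Finset.sum_congr rfl fun k hk => ?_
      have hk' := Finset.ne_of_mem_erase hk
      simp [signVec, hk']
  have hz : S.combine (Function.update z i (z i + τ * (t * ∑ k ∈ A, z k))) =
      S.combine z + (τ * (t * ∑ k ∈ A, z k)) • S.cellVec i := by
    unfold CellFamily.combine
    rw [← Finset.add_sum_erase _ _ (Finset.mem_univ i),
      ← Finset.add_sum_erase _ (fun k => z k • S.cellVec k) (Finset.mem_univ i), add_right_comm]
    congr 1
    · simp [add_smul]
    · refine Finset.sum_congr rfl fun k hk => ?_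
      rw [Function.update_of_ne (Finset.ne_of_mem_erase hk)]
  rw [hw, hz, smul_add, smul_smul, mul_comm τ]
  abel

theorem lintegral_sum_sq (t : ℝ) (A : Finset ι) :
    ∫⁻ x, ENNReal.ofReal ((t * ∑ k ∈ A, x k) ^ 2) ∂whiteNoise ι =
      ENNReal.ofReal (t ^ 2 * A.card) := by
  have h : ∀ x : ι → ℝ, (t * ∑ k ∈ A, x k) ^ 2 =
      (∑ k, (t * indic A k) * x k) * ∑ k, (t * indic A k) * x k := fun x => by
    simp_rw [mul_assoc, ← Finset.mul_sum, sum_indic_mul]; ring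
  simp_rw [h]
  rw [← ofReal_integral_eq_lintegral_ofReal, integral_linear_mul_linear]
  · congr 1
    rw [← sum_indic_sq A, Finset.mul_sum]
    exact Finset.sum_congr rfl fun k _ => by ring
  · have hm : MemLp (fun x : ι → ℝ => ∑ k, (t * indic A k) * x k) 2 (whiteNoise ι) :=
      memLp_finsetSum _ fun k _ => (memLp_coord k).const_mul _
    exact hm.integrable_mul hm
  · exact Filter.Eventually.of_forall fun x => mul_self_nonneg _

/-- The sign vector `± 1` of a Boolean vector. -/
def toSign {ι : Type*} (b : ι → Bool) (i : ι) : ℝ := if b i then 1 else -1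

theorem abs_toSign {ι : Type*} (b : ι → Bool) (i : ι) : |toSign b i| = 1 := by
  unfold toSign; split_ifs <;> simp

theorem toSign_update {ι : Type*} [DecidableEq ι] (b : ι → Bool) (i : ι) (c : Bool) :
    toSign (Function.update b i c) = Function.update (toSign b) i (if c then 1 else -1) := by
  ext j
  by_cases h : j = i
  · subst h; simp [toSign]
  · simp [toSign, h]

/-- Averaging a quantity over all sign patterns, when flipping one sign makes the sum of two
values at least `q`. -/
theorem card_mul_le_sum_of_flip (Q : (ι → Bool) → ℝ≥0∞) (i : ι) {q : ℝ≥0∞}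
    (h : ∀ b, q ≤ Q (Function.update b i true) + Q (Function.update b i false)) :
    (Fintype.card (ι → Bool) : ℝ≥0∞) * q ≤ 2 * ∑ b, Q b := by
  have hinv : Function.Involutive fun b : ι → Bool => Function.update b i (!b i) := fun b => by
    simp
  have hflip : ∑ b, Q (Function.update b i (!b i)) = ∑ b, Q b :=
    Equiv.sum_comp (hinv.toPerm _) Q
  rw [two_mul]
  nth_rewrite 2 [← hflip]
  rw [← Finset.sum_add_distrib, ← nsmul_eq_mul, ← Finset.card_univ, ← Finset.sum_const]
  refine Finset.sum_le_sum fun b _ => ?_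
  cases hb : b i
  · have h1 := h b
    rw [add_comm] at h1
    have h2 : Function.update b i false = b := by rw [← hb]; simp
    rwa [h2] at h1
  · have h1 := h b
    have h2 : Function.update b i true = b := by rw [← hb]; simp
    rwa [h2] at h1

/-- Assouad's argument over the sign patterns `θ` of the regression of the coordinates in `B` on the
sum of the coordinates in `A`. -/
theorem CellFamily.le_risk_of_spike {t : ℝ} (ht : 0 ≤ t) {A B : Finset ι} {p : ℕ} (hp : 0 < p)
    (hA : A.card = p) (hB : B.card = p) (hAB : Disjoint A B) (htp : t * p ≤ 1)
    (hN : N * (t ^ 2 * p) ≤ 1 / 2)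
    {T : (Fin N → L2 d) → (L2 d →L[ℝ] L2 d)} (hT : IsEstimator T) {M : ℝ≥0∞}
    (hM : ∀ b, relRisk T (S.spikeOp t A B (toSign b)) (gaussLaw fun k =>
      S.combine (spikeMat t (indic A) (signVec B (toSign b)) k)) ≤ M) :
    ENNReal.ofReal (t * p / 16) ≤ M := by
  set u := S.testVec A with hu
  have hu1 : ‖u‖ = 1 := S.norm_testVec (by omega)
  have hp' : (0 : ℝ) < p := by exact_mod_cast hp
  set a := t * √p with ha
  have ha0 : 0 ≤ a := by positivity
  let U : (ι → ℝ) → (Fin N → ι → ℝ) → Fin N → L2 d := fun θ z n =>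
    synth (fun k => S.combine (spikeMat t (indic A) (signVec B θ) k)) (z n)
  have hU : ∀ θ, Measurable (U θ) := fun θ =>
    measurable_pi_lambda _ fun n => (synth _).continuous.measurable.comp (measurable_pi_apply n)
  let Q : ι → (ι → ℝ) → ℝ≥0∞ := fun i θ =>
    ∫⁻ z, ENNReal.ofReal |⟪T (U θ z) u, S.cellVec i⟫ - a * θ i| ∂noiseSample N ι
  have hloss : ∀ b, ENNReal.ofReal (√p)⁻¹ * ∑ i ∈ B, Q i (toSign b) ≤ M * 4 := by
    intro b
    have four : ENNReal.ofReal 4 = 4 := by norm_num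
    have key := (le_relRisk (fun k => S.combine (spikeMat t (indic A) (signVec B (toSign b)) k)) T
      (K := 4) (S.norm_spikeOp_le hA hB (abs_toSign b) ht htp)
      (fun V => ENNReal.ofReal (√p)⁻¹ * ∑ i ∈ B,
        ENNReal.ofReal |⟪T V u, S.cellVec i⟫ - a * toSign b i|)
      (by
        refine Measurable.const_mul (Finset.measurable_sum _ fun i _ => ?_) _
        exact (((hT u (S.cellVec i)).sub_const _).norm).ennreal_ofReal)
      fun V => ?_).trans (hM b)
    · rw [four] at key
      have key := (ENNReal.div_le_iff (by norm_num) (by norm_num)).1 key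
      refine le_trans (le_of_eq ?_) key
      rw [lintegral_const_mul' _ _ ENNReal.ofReal_ne_top, lintegral_finsetSum _ fun i _ => ?_]
      have := (((hT u (S.cellVec i)).comp (hU (toSign b))).sub_const (a * toSign b i)).norm
      exact this.ennreal_ofReal
    · have := S.sum_abs_le_enorm (T V) (S.spikeOp t A B (toSign b)) hu1 (B := B) (by omega)
      rw [hB] at this
      refine le_trans (le_of_eq ?_) this
      congr 1
      refine Finset.sum_congr rfl fun i hi => ?_
      rw [S.inner_spikeOp_testVec hAB (by omega) _ hi, hA]
  have hpair : ∀ i ∈ B, ∀ b : ι → Bool, ENNReal.ofReal (a / 2) ≤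
      Q i (toSign (Function.update b i true)) + Q i (toSign (Function.update b i false)) := by
    intro i hi b
    have hiA : i ∉ A := fun h => Finset.disjoint_left.1 hAB h hi
    have htwo := two_point_shear (N := N) i (s := fun x => t * ∑ k ∈ A, x k) (by fun_prop)
      (fun x y => by
        congr 1
        exact Finset.sum_congr rfl fun k hk =>
          Function.update_of_ne (ne_of_mem_of_not_mem hk hiA) _ _)
      (by
        rw [lintegral_sum_sq, hA, ← ENNReal.ofReal_natCast, ← ENNReal.ofReal_mul (by positivity)]
        exact ENNReal.ofReal_le_ofReal hN)
      (g := fun z => ⟪T (U (Function.update (toSign b) i 0) z) u, S.cellVec i⟫)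
      ((hT u (S.cellVec i)).comp (hU _)) ha0
    refine htwo.trans (le_of_eq ?_)
    simp only [Q, U, toSign_update, if_true, Bool.false_eq_true, if_false, Function.update_self,
      mul_one, mul_neg, sub_neg_eq_add]
    congr 1
    · refine lintegral_congr fun z => ?_
      simp_rw [S.synth_spike_update t hAB (toSign b) hi _ 1, one_mul]
    · refine lintegral_congr fun z => ?_
      simp_rw [S.synth_spike_update t hAB (toSign b) hi _ (-1), neg_one_mul, ← sub_eq_add_neg]
  set W : ℝ≥0∞ := (Fintype.card (ι → Bool) : ℝ≥0∞) with hW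
  have hW0 : W ≠ 0 := by simp [hW]
  have hWt : W ≠ ∞ := by simp [hW]
  have hmain : W * ENNReal.ofReal (t * p / 2) ≤ W * (M * 8) := by
    calc W * ENNReal.ofReal (t * p / 2)
        = ENNReal.ofReal (√p)⁻¹ * ∑ _i ∈ B, W * ENNReal.ofReal (a / 2) := by
          rw [Finset.sum_const, hB, nsmul_eq_mul, ← ENNReal.ofReal_natCast, mul_left_comm _ W,
            mul_left_comm _ W, ← ENNReal.ofReal_mul (by positivity),
            ← ENNReal.ofReal_mul (by positivity)]
          congr 2
          rw [ha]
          have : √(p : ℝ) ≠ 0 := (Real.sqrt_pos.2 hp').ne'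
          field_simp
      _ ≤ ENNReal.ofReal (√p)⁻¹ * ∑ i ∈ B, 2 * ∑ b, Q i (toSign b) := by
          refine mul_le_mul' le_rfl (Finset.sum_le_sum fun i hi => ?_)
          exact card_mul_le_sum_of_flip (fun b => Q i (toSign b)) i (hpair i hi)
      _ = 2 * ∑ b, ENNReal.ofReal (√p)⁻¹ * ∑ i ∈ B, Q i (toSign b) := by
          rw [← Finset.mul_sum, ← Finset.mul_sum, Finset.sum_comm]; ring
      _ ≤ 2 * ∑ _b : ι → Bool, M * 4 :=
          mul_le_mul' le_rfl (Finset.sum_le_sum fun b _ => hloss b)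
      _ = W * (M * 8) := by
          rw [Finset.sum_const, Finset.card_univ, nsmul_eq_mul, ← hW]; ring
  have hfin := (ENNReal.mul_le_mul_iff_right hW0 hWt).1 hmain
  have e : t * p / 16 = t * p / 2 / 8 := by ring
  rw [e, ENNReal.ofReal_div_of_pos (by norm_num)]
  refine ENNReal.div_le_of_le_mul (hfin.trans (le_of_eq ?_))
  norm_num

/-- The entries of the Gram matrix between `A` and `B` are `± t`, those inside `B` are off by
`± t² p`; so the off-diagonal row sums are at most `t p + (t p)² ≤ 2 t p`, and the trace exceeds `card ι` by
`(t p)² ≤ 1`. -/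
theorem CellFamily.spikeOp_mem_bandedClass [Nonempty ι] {t : ℝ} (ht : 0 ≤ t) {A B : Finset ι}
    {p : ℕ} (hp : 0 < p) (hA : A.card = p) (hB : B.card = p) (hAB : Disjoint A B)
    (htp : t * p ≤ 1) {θ : ι → ℝ} (hθ : ∀ i, |θ i| = 1) {c₁ c₂ r : ℝ} {ν : ℕ+ → ℝ}
    (hc₂ : 0 < c₂) (hνpos : ∀ m, 0 < ν m) (hν : Antitone ν) (hr : Fintype.card ι + 1 ≤ r)
    (hc₁ : 0 ≤ c₁) (hcard : v⁻¹ * 2 ≤ c₁ * Fintype.card ι)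
    (hcell : ∀ i, ∀ x ∈ S.cell i, ∀ y ∈ S.cell i, euclDist x y ≤ r ^ (-(1 / d : ℝ)))
    (m : ℕ+) (hloc : ∀ i ∈ A ∪ B, ∀ j ∈ A ∪ B, ∀ x ∈ S.cell i, ∀ y ∈ S.cell j,
      euclDist x y ≤ m * r ^ (-(1 / d : ℝ)))
    (htν : 2 * (t * p) ≤ c₂ * ν m) :
    S.spikeOp t A B θ ∈ bandedClass d c₁ c₂ r ν := by
  have hp' : (1 : ℝ) ≤ p := by exact_mod_cast hp
  set h := indic A with hh
  set w := signVec B θ with hw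
  have hhw : ∀ i, h i * w i = 0 := fun i => by
    simp only [hh, hw, indic, signVec]
    by_cases hi : i ∈ A
    · simp [hi, Finset.disjoint_left.1 hAB hi]
    · simp [hi]
  have hw1 : ∀ i, w i ^ 2 ≤ 1 := fun i => by
    simp only [hw, signVec]
    split_ifs
    · rw [← sq_abs, hθ, one_pow]
    · simp
  have hdiag : ∀ i, gram (spikeMat t h w) i i = 1 + t ^ 2 * p * w i ^ 2 := fun i => by
    rw [gram_spikeMat, if_pos rfl, hh, sum_indic_sq, hA]
    linear_combination (2 * t) * hhw i
  have htp2 : t ^ 2 * p ≤ 1 := by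
    have : t ≤ t * p := le_mul_of_one_le_right ht hp'
    nlinarith
  obtain ⟨i₀, hi₀⟩ : A.Nonempty := Finset.card_pos.1 (by omega)
  have hnorm : 1 ≤ ‖S.spikeOp t A B θ‖ := by
    have := sq_le_norm_covOp (fun k => S.combine (spikeMat t h w k))
      (S.orthonormal_cellVec.norm_eq_one i₀) i₀
    rw [S.inner_combine_cellVec] at this
    refine le_trans (le_of_eq ?_) this
    rw [spikeMat, if_pos rfl, mul_assoc, hhw]
    norm_num
  refine S.covOp_mem_bandedClass (spikeMat t h w) hc₂ hνpos hν hnorm ?_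
    (fun i => ?_) (fun i => ?_) hc₁ hcard hcell m (fun i j hij hg => ?_) fun i => ?_
  · have : ∑ k, ∑ i, spikeMat t h w k i ^ 2 = Fintype.card ι + (t * p) ^ 2 := by
      rw [Finset.sum_comm]
      have e : ∀ i, ∑ k, spikeMat t h w k i ^ 2 = gram (spikeMat t h w) i i := fun i =>
        Finset.sum_congr rfl fun k _ => sq _
      simp_rw [e, hdiag, Finset.sum_add_distrib, ← Finset.mul_sum, hw, sum_signVec_sq hθ, hB]
      simp
      ring
    rw [this]
    have h1 : (t * p) ^ 2 ≤ 1 := by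
      have : 0 ≤ t * p := by positivity
      nlinarith
    have h0 : 0 ≤ r := le_trans (by positivity) hr
    calc (Fintype.card ι : ℝ) + (t * p) ^ 2 ≤ r * 1 := by linarith
      _ ≤ _ := mul_le_mul_of_nonneg_left hnorm h0
  · rw [hdiag]
    have : 0 ≤ t ^ 2 * p * w i ^ 2 := by positivity
    linarith
  · rw [hdiag]
    have : t ^ 2 * p * w i ^ 2 ≤ 1 * 1 := by gcongr; exact hw1 i
    linarith
  · have hsupp : ∀ l, l ∉ A ∪ B → h l = 0 ∧ w l = 0 := fun l hl => by
      rw [Finset.mem_union, not_or] at hl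
      exact ⟨by simp [hh, indic, hl.1], by simp [hw, signVec, hl.2]⟩
    refine hloc i ?_ j ?_
    · by_contra hi
      refine hg ?_
      rw [gram_spikeMat, if_neg hij, (hsupp i hi).1, (hsupp i hi).2]; ring
    · by_contra hj
      refine hg ?_
      rw [gram_spikeMat, if_neg hij, (hsupp j hj).1, (hsupp j hj).2]; ring
  · have hh0 : ∀ j, 0 ≤ h j := fun j => by simp only [hh, indic]; split_ifs <;> norm_num
    have hle : ∀ j ∈ Finset.univ.erase i, |gram (spikeMat t h w) i j| ≤
        t * h i * |w j| + t * |w i| * h j + t ^ 2 * p * |w i| * |w j| := fun j hj => by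
      rw [gram_spikeMat, if_neg (Finset.ne_of_mem_erase hj).symm, zero_add, hh, sum_indic_sq, hA,
        ← hh]
      refine (abs_add_le _ _).trans (add_le_add ((abs_add_le _ _).trans (add_le_add ?_ ?_)) ?_)
      · rw [abs_mul, abs_mul, abs_of_nonneg ht, abs_of_nonneg (hh0 i)]
      · rw [abs_mul, abs_mul, abs_of_nonneg ht, abs_of_nonneg (hh0 j), mul_right_comm]
      · rw [abs_mul, abs_mul, abs_mul, abs_of_nonneg (sq_nonneg t), Nat.abs_cast, ← mul_assoc]
    have hiw : h i + |w i| ≤ 1 := by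
      simp only [hh, hw, indic, signVec]
      by_cases hi : i ∈ A
      · simp [hi, Finset.disjoint_left.1 hAB hi]
      · simp only [hi, if_false, zero_add]
        split_ifs <;> simp [hθ]
    have hwi : |w i| ≤ 1 := by linarith [hh0 i]
    have htp0 : 0 ≤ t * p := by positivity
    calc ∑ j ∈ Finset.univ.erase i, |gram (spikeMat t h w) i j|
        ≤ ∑ j ∈ Finset.univ.erase i,
          (t * h i * |w j| + t * |w i| * h j + t ^ 2 * p * |w i| * |w j|) :=
          Finset.sum_le_sum hle
      _ ≤ ∑ j, (t * h i * |w j| + t * |w i| * h j + t ^ 2 * p * |w i| * |w j|) := by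
          refine Finset.sum_le_sum_of_subset_of_nonneg (Finset.erase_subset _ _) fun j _ _ => ?_
          have := hh0 i
          have := hh0 j
          positivity
      _ = (h i + |w i|) * (t * p) + |w i| * (t * p) ^ 2 := by
          simp_rw [Finset.sum_add_distrib, ← Finset.mul_sum, hw, sum_abs_signVec hθ, hh, sum_indic,
            hA, hB]
          ring
      _ ≤ 1 * (t * p) + 1 * (t * p) ^ 2 := by gcongr
      _ ≤ 2 * (t * p) := by nlinarith
      _ ≤ _ := htν

end Spike

/-! ### The lower bound at a given bandwidth -/

/-- In a grid whose block of side `m` has at least `2 p` cells, one can choose `R ≥ 2 p` cells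
and two disjoint sets of `p` of them inside the block. -/
theorem exists_cells {d n m p R : ℕ} (hmn : m ≤ n) (hp : 2 * p ≤ m ^ d) (hpR : 2 * p ≤ R)
    (hR : R ≤ n ^ d) :
    ∃ (F : Finset (Fin d → Fin n)) (A B : Finset F), F.card = R ∧ A.card = p ∧ B.card = p ∧
      Disjoint A B ∧ ∀ κ ∈ A ∪ B, ∀ t, (κ.1 t : ℕ) < m := by
  classical
  let g : (Fin d → Fin m) → Fin d → Fin n := fun f t => Fin.castLE hmn (f t)
  have hg : Function.Injective g := fun f f' h => funext fun t =>
    Fin.castLE_injective hmn (congrFun h t)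
  set K : Finset (Fin d → Fin n) := Finset.univ.image g with hK
  have hKc : K.card = m ^ d := by rw [hK, Finset.card_image_of_injective _ hg]; simp
  have hKm : ∀ κ ∈ K, ∀ t, (κ t : ℕ) < m := by
    intro κ hκ t
    obtain ⟨f, -, rfl⟩ := Finset.mem_image.1 hκ
    exact (f t).2
  obtain ⟨A, hAK, hA⟩ := Finset.exists_subset_card_eq (show p ≤ K.card by omega)
  obtain ⟨B, hBK, hB⟩ := Finset.exists_subset_card_eq (show p ≤ (K \ A).card by
    rw [Finset.card_sdiff_of_subset hAK]; omega)
  have hAB : Disjoint A B := Finset.disjoint_of_subset_right hBK Finset.disjoint_sdiff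
  obtain ⟨F, hF1, -, hF⟩ := Finset.exists_subsuperset_card_eq (Finset.subset_univ (A ∪ B))
    (show (A ∪ B).card ≤ R by rw [Finset.card_union_of_disjoint hAB]; omega)
    (show R ≤ (Finset.univ : Finset (Fin d → Fin n)).card by simpa using hR)
  have hAF : ∀ x ∈ A, x ∈ F := fun x hx => hF1 (Finset.mem_union_left _ hx)
  have hBF : ∀ x ∈ B, x ∈ F := fun x hx => hF1 (Finset.mem_union_right _ hx)
  refine ⟨F, A.subtype (· ∈ F), B.subtype (· ∈ F), hF, ?_, ?_, ?_, fun κ hκ => ?_⟩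
  · rw [Finset.card_subtype, Finset.filter_true_of_mem hAF, hA]
  · rw [Finset.card_subtype, Finset.filter_true_of_mem hBF, hB]
  · rw [Finset.disjoint_left]
    intro x hx hx'
    rw [Finset.mem_subtype] at hx hx'
    exact Finset.disjoint_left.1 hAB hx hx'
  · rw [Finset.mem_union, Finset.mem_subtype, Finset.mem_subtype] at hκ
    exact hκ.elim (fun h => hKm _ (hAK h)) fun h => hKm _ (Finset.sdiff_subset (hBK h))

/-- The lower bound of order `min (ν m) √(m ^ d / N)` from sign patterns inside a block of `m ^ d`
cells. -/
theorem minimaxRisk_ge_band {d : ℕ} (hd : 1 ≤ d) {c₁ c₂ : ℝ} (hc₁ : 8 * (2 * d : ℝ) ^ d ≤ c₁)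
    (hc₂ : 0 < c₂) {ν : ℕ+ → ℝ} (hν1 : ν 1 = 1) (hνpos : ∀ m, 0 < ν m) (hν : Antitone ν)
    {N : ℕ} (hN : 0 < N) {r : ℝ} {m : ℕ+} (hm4 : 4 ≤ (m : ℕ) ^ d) (hmr : (m : ℝ) ^ d ≤ r) :
    ENNReal.ofReal (min 1 (c₂ / 2) * min (ν m) √((m : ℝ) ^ d / N) / 64) ≤
      minimaxRisk d N (bandedClass d c₁ c₂ r ν) := by
  have hN' : (0 : ℝ) < N := by exact_mod_cast hN
  have hr4 : 4 ≤ r := le_trans (by exact_mod_cast hm4) hmr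
  have hd' : (1 : ℝ) ≤ d := by exact_mod_cast hd
  obtain ⟨n, hn, hn1, hn2, hn3⟩ := exists_grid hd (show 1 ≤ r by linarith)
  have hmn : (m : ℕ) ≤ n := by
    have h1 : (m : ℝ) ≤ r ^ (1 / d : ℝ) := by
      rw [one_div]
      refine (Real.le_rpow_inv_iff_of_pos (by positivity) (by linarith) (by positivity)).2 ?_
      rw [Real.rpow_natCast]; exact hmr
    have h2 : (m : ℝ) ≤ n := by
      refine le_trans ?_ hn1
      nlinarith [show (0 : ℝ) ≤ m by positivity]
    exact_mod_cast h2
  set p := (m : ℕ) ^ d / 4 with hp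
  have hp0 : 0 < p := Nat.div_pos hm4 (by norm_num)
  have hp4 : 4 * p ≤ (m : ℕ) ^ d := Nat.mul_div_le _ _
  have hp8 : (m : ℕ) ^ d ≤ 8 * p := by omega
  have hp' : (1 : ℝ) ≤ p := by exact_mod_cast hp0
  have hp4' : 4 * (p : ℝ) ≤ (m : ℝ) ^ d := by exact_mod_cast hp4
  have hp8' : (m : ℝ) ^ d ≤ 8 * p := by exact_mod_cast hp8
  -- one cell less than `⌊r⌋` leaves room for the trace `(t * p) ^ 2 ≤ 1` of the perturbation
  obtain ⟨R, hRr, hrR⟩ : ∃ R : ℕ, (R : ℝ) + 1 ≤ r ∧ r < R + 2 := by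
    refine ⟨⌊r⌋₊ - 1, ?_, ?_⟩
    all_goals
      have h1 : 1 ≤ ⌊r⌋₊ := Nat.le_floor (by simp; linarith)
      have h2 := Nat.floor_le (show 0 ≤ r by linarith)
      have h3 := Nat.lt_floor_add_one r
      rw [Nat.cast_sub h1]; push_cast; linarith
  have hpR : 2 * p ≤ R := by
    have : (2 * p : ℝ) ≤ R := by linarith
    exact_mod_cast this
  have hRn : R ≤ n ^ d := by
    have : (R : ℝ) ≤ (n : ℝ) ^ d := by linarith
    exact_mod_cast this
  obtain ⟨F, A, B, hF, hA, hB, hAB, hloc⟩ := exists_cells hmn (by omega) hpR hRn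
  let S := gridFamily d n hn (fun κ : F => κ.1) Subtype.val_injective
  have hcardF : Fintype.card F = R := by rw [Fintype.card_coe, hF]
  have hne : Nonempty F := by
    rw [← Fintype.card_pos_iff, hcardF]; omega
  set μ := min (ν m) √((m : ℝ) ^ d / N) with hμ
  have hμν : μ ≤ ν m := min_le_left _ _
  have hμ0 : 0 ≤ μ := le_min (hνpos m).le (Real.sqrt_nonneg _)
  have hμ1 : μ ≤ 1 := hμν.trans (hν1 ▸ hν one_le)
  have hμ2 : μ ^ 2 ≤ (m : ℝ) ^ d / N := by
    rw [← Real.sq_sqrt (show 0 ≤ (m : ℝ) ^ d / N by positivity)]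
    gcongr
    exact min_le_right _ _
  set b := min 1 (c₂ / 2) with hb
  have hb0 : 0 ≤ b := by positivity
  have hb1 : b ≤ 1 := min_le_left _ _
  have hb2 : b ≤ c₂ / 2 := min_le_right _ _
  -- the size of the perturbation in operator norm is `t * p`
  set t := b * μ / 4 / p with ht
  have htp : t * p = b * μ / 4 := div_mul_cancel₀ _ (by positivity)
  have ht0 : 0 ≤ t := by positivity
  have hbμ : b * μ ≤ μ := mul_le_of_le_one_left hμ0 hb1
  have hNt : N * (t ^ 2 * p) ≤ 1 / 2 := by
    have h1 : (t * p) ^ 2 ≤ p / (2 * N) := by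
      calc (t * p) ^ 2 = (b * μ) ^ 2 / 16 := by rw [htp]; ring
        _ ≤ μ ^ 2 / 16 := by gcongr
        _ ≤ ((m : ℝ) ^ d / N) / 16 := by gcongr
        _ ≤ (8 * p / N) / 16 := by gcongr
        _ = p / (2 * N) := by field_simp; norm_num
    rw [le_div_iff₀ (by positivity)] at h1
    have h2 : p * (N * (t ^ 2 * p)) ≤ p * (1 / 2) := by nlinarith
    exact le_of_mul_le_mul_left h2 (by positivity)
  have hcard : ((n : ℝ) ^ d)⁻¹⁻¹ * 2 ≤ c₁ * Fintype.card F := by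
    rw [inv_inv, hcardF]
    calc (n : ℝ) ^ d * 2 ≤ (2 * d : ℝ) ^ d * r * 2 := by gcongr
      _ ≤ (2 * d : ℝ) ^ d * (4 * R) * 2 := by gcongr; linarith
      _ = 8 * (2 * d : ℝ) ^ d * R := by ring
      _ ≤ c₁ * R := by gcongr
  refine le_iInf₂ fun T hT => ?_
  refine le_trans (ENNReal.ofReal_le_ofReal (le_of_eq ?_))
    (S.le_risk_of_spike ht0 hp0 hA hB hAB (by rw [htp]; linarith) hNt hT fun σ =>
      relRisk_le_iSup _ ?_ T)
  · rw [htp]; ring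
  · refine S.spikeOp_mem_bandedClass ht0 hp0 hA hB hAB (by rw [htp]; linarith) (abs_toSign σ)
      hc₂ hνpos hν (by rw [hcardF]; exact hRr) (le_trans (by positivity) hc₁) hcard
      (fun i x hx y hy => euclDist_gridCell_self_le hd (by linarith) hn1 hx hy) m
      (fun i hi j hj x hx y hy => euclDist_gridCell_block_le hd (by linarith) hn1 (hloc i hi)
        (hloc j hj) hx hy) ?_
    rw [htp]
    have : b * μ ≤ c₂ / 2 * ν m := by gcongr
    have h3 := mul_pos hc₂ (hνpos m)
    nlinarith

/-- For effective dimension `r` only bandwidths `m` with `m ^ d ≤ r` matter, up to a constant. -/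
theorem exists_bandwidth {d : ℕ} (hd : 1 ≤ d) {ν : ℕ+ → ℝ} (hνpos : ∀ m, 0 < ν m)
    (hν : Antitone ν) {N : ℕ} (hN : 1 ≤ N) {r : ℝ} (hr : 1 ≤ r) :
    ∃ m : ℕ+, (m : ℝ) ^ d ≤ r ∧ min (epsStar ν N d) √(r / N) ≤
      2 ^ d * min (ν m) √((m : ℝ) ^ d / N) := by
  have hN' : (0 : ℝ) < N := by exact_mod_cast hN
  have h2d : (1 : ℝ) ≤ 2 ^ d := one_le_pow₀ (by norm_num)
  obtain ⟨m₀, hm₀⟩ := (isGreatest_epsStar hν hN hd).1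
  simp only at hm₀
  by_cases h : (m₀ : ℝ) ^ d ≤ r
  · refine ⟨m₀, h, ?_⟩
    rw [← hm₀]
    exact (min_le_left _ _).trans
      (le_mul_of_one_le_left (le_min (hνpos m₀).le (Real.sqrt_nonneg _)) h2d)
  · push Not at h
    have hqd : (r ^ (1 / d : ℝ)) ^ d = r := by
      rw [one_div]; exact Real.rpow_inv_natCast_pow (by linarith) (by omega)
    have hq : 1 ≤ r ^ (1 / d : ℝ) := Real.one_le_rpow hr (by positivity)
    set q := r ^ (1 / d : ℝ)
    have hq1 : 1 ≤ ⌊q⌋₊ := Nat.le_floor (by simpa using hq)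
    have hq2 : (⌊q⌋₊ : ℝ) ≤ q := Nat.floor_le (by linarith)
    have hq3 : q ≤ 2 * ⌊q⌋₊ := by
      have h1 := Nat.lt_floor_add_one q
      have h2 : (1 : ℝ) ≤ ⌊q⌋₊ := by exact_mod_cast hq1
      linarith
    obtain ⟨m, hm⟩ : ∃ m : ℕ+, (m : ℕ) = ⌊q⌋₊ := ⟨⟨⌊q⌋₊, hq1⟩, rfl⟩
    rw [← hm] at hq2 hq3
    have hmr : (m : ℝ) ^ d ≤ r := by
      calc (m : ℝ) ^ d ≤ q ^ d := by gcongr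
        _ = r := hqd
    have hrm : r ≤ 2 ^ d * (m : ℝ) ^ d := by
      calc r = q ^ d := hqd.symm
        _ ≤ (2 * m) ^ d := by gcongr
        _ = _ := mul_pow _ _ _
    have hmm : m ≤ m₀ := by
      have : (m : ℝ) < m₀ := lt_of_pow_lt_pow_left₀ d (by positivity) (hmr.trans_lt h)
      exact_mod_cast this.le
    refine ⟨m, hmr, ?_⟩
    rw [mul_min_of_nonneg _ _ (by positivity)]
    refine min_le_min ?_ ?_
    · calc epsStar ν N d ≤ ν m₀ := by rw [← hm₀]; exact min_le_left _ _
        _ ≤ ν m := hν hmm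
        _ ≤ _ := le_mul_of_one_le_left (hνpos m).le h2d
    · refine Real.sqrt_le_iff.2 ⟨by positivity, ?_⟩
      rw [mul_pow, Real.sq_sqrt (by positivity), mul_div_assoc']
      gcongr
      refine hrm.trans ?_
      gcongr
      exact le_self_pow₀ h2d two_ne_zero

end BandedCovariance

theorem mainTheorem2 (d : ℕ) (hd : 1 ≤ d) :
    ∃ C₀ : ℝ, 0 < C₀ ∧ ∀ c₁ : ℝ, C₀ ≤ c₁ → ∀ c₂ : ℝ, 0 < c₂ →
      ∃ c : ℝ, 0 < c ∧
        ∀ (ν : ℕ+ → ℝ), ν 1 = 1 → (∀ m, 0 < ν m) → Antitone ν →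
        ∀ (N : ℕ) (r : ℝ), 1 < r → Real.log r < N →
          ENNReal.ofReal
              (c * min (BandedCovariance.epsStar ν N d + √(Real.log r / N)) √(r / N)) ≤
            BandedCovariance.minimaxRisk d N (BandedCovariance.bandedClass d c₁ c₂ r ν) := by
  have hd' : (1 : ℝ) ≤ d := by exact_mod_cast hd
  refine ⟨8 * (2 * d : ℝ) ^ d, by positivity, fun c₁ hc₁ c₂ hc₂ => ?_⟩
  have h2d : (1 : ℝ) ≤ 2 ^ d := one_le_pow₀ (by norm_num)
  set b := min 1 (c₂ / 2) with hb
  have hb0 : 0 < b := lt_min one_pos (by positivity)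
  have hb1 : b ≤ 1 := min_le_left _ _
  refine ⟨b / (2 ^ d * 1024), by positivity, fun ν hν1 hνpos hν N r hr hlogN => ?_⟩
  have hlog : 0 < Real.log r := Real.log_pos hr
  have hN : 0 < N := by exact_mod_cast hlog.trans hlogN
  have hN' : (0 : ℝ) < N := by exact_mod_cast hN
  obtain ⟨m, hmr, hm⟩ := BandedCovariance.exists_bandwidth hd hνpos hν (N := N) hN hr.le
  have hbase := BandedCovariance.minimaxRisk_ge_log hd hc₁ hc₂ hνpos hν hr hlogN
  set x := min (ν m) √((m : ℝ) ^ d / N) with hx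
  set y := √((1 + Real.log r) / N) with hy
  have hx0 : 0 ≤ x := le_min (hνpos m).le (Real.sqrt_nonneg _)
  have hy0 : 0 ≤ y := Real.sqrt_nonneg _
  have hly : √(Real.log r / N) ≤ y := by
    rw [hy]; gcongr; linarith
  have hsplit : min (BandedCovariance.epsStar ν N d + √(Real.log r / N)) √(r / N) ≤
      2 ^ d * x + y := by
    refine le_trans ?_ (add_le_add hm hly)
    rw [← min_add_add_right]
    exact min_le_min le_rfl (le_add_of_nonneg_right (Real.sqrt_nonneg _))
  have hscale : b / (2 ^ d * 1024) * min (BandedCovariance.epsStar ν N d + √(Real.log r / N))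
      √(r / N) ≤ b * x / 1024 + b * y / 1024 := by
    calc _ ≤ b / (2 ^ d * 1024) * (2 ^ d * x + 2 ^ d * y) := by
          gcongr
          exact hsplit.trans (by gcongr; exact le_mul_of_one_le_left hy0 h2d)
      _ = _ := by field_simp
  have hby : b * y ≤ y := mul_le_of_le_one_left hy0 hb1
  by_cases hm4 : 4 ≤ (m : ℕ) ^ d
  · have hband := BandedCovariance.minimaxRisk_ge_band hd hc₁ hc₂ hν1 hνpos hν hN hm4 hmr
    refine le_trans (ENNReal.ofReal_le_ofReal (hscale.trans ?_)) (le_trans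
      (ENNReal.ofReal_max _ _).le (max_le hband hbase))
    have h1 := le_max_left (b * x / 64) (y / 256)
    have h2 := le_max_right (b * x / 64) (y / 256)
    have h3 : 0 ≤ b * x := by positivity
    linarith
  · -- for `m ^ d < 4` the parametric rate `1 / √N` dominates
    refine le_trans (ENNReal.ofReal_le_ofReal (hscale.trans ?_)) hbase
    have hxy : x ≤ 2 * y := by
      refine (min_le_right _ _).trans ?_
      have h4 : (m : ℝ) ^ d ≤ 4 := by
        have : (m : ℕ) ^ d ≤ 4 := by omega
        exact_mod_cast this
      refine Real.sqrt_le_iff.2 ⟨by positivity, ?_⟩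
      rw [mul_pow, Real.sq_sqrt (by positivity), mul_div_assoc']
      gcongr
      linarith
    have : b * x ≤ 2 * y := (mul_le_of_le_one_left hx0 hb1).trans hxy
    linarith
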